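/- Let $K$ be an algebraically closed field of characteristic $0$; varieties are irreducible. For subvarieties $X,Y\subseteq\mathbb{P}^n_K$, let the Hadamard product $X\odot Y$ be the Zariski closure of the set of points $[p_0q_0:\dots:p_nq_n]$ with $[p_0:\dots:p_n]\in X$, $[q_0:\dots:q_n]\in Y$ and not all $p_jq_j$ zero, and let $X_1\odot\cdots\odot X_\ell=(\cdots(X_1\odot X_2)\odot\cdots)\odot X_\ell$. Let $\ell\ge 1$ and $h_1,\dots,h_\ell\ge 0$ be integers and let $n\geq (h_1+1)\cdots(h_\ell+1)-1$. For generic linear subspaces $L_1,\dots,L_\ell$ of $\mathbb{P}^n$ of dimensions $h_1,\dots,h_\ell$ (that is, for all $(L_1,\dots,L_\ell)$ in some nonempty Zariski open subset of the product of Grassmannians $\mathbb{G}(h_1,n)\times\cdots\times\mathbb{G}(h_\ell,n)$, depending only on $K$, $n$ and $(h_1,\dots,h_\ell)$), the following holds. For all subvarieties $X_1,\dots,X_\ell$ of $\mathbb{P}^n$ with $X_i\subseteq L_i$ for every $i$, the Hadamard product $X_1\odot\cdots\odot X_\ell$ is a subvariety of $\mathbb{P}^n$ that is projectively equivalent to the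 product variety $X_1\times\cdots\times X_\ell$, embedded in $\mathbb{P}^n$ by $$X_1\times\cdots\times X_\ell\subseteq L_1\times\cdots\times L_\ell\cong\mathbb{P}^{h_1}\times\cdots\times\mathbb{P}^{h_\ell}\hookrightarrow\mathbb{P}^{(h_1+1)\cdots(h_\ell+1)-1}\subseteq\mathbb{P}^n,$$ where the isomorphisms $L_i\cong\mathbb{P}^{h_i}$ are any linear ones, the second map is the Segre embedding, and the last inclusion is that of any coordinate subspace; i.e. some element of $\mathrm{PGL}_{n+1}(K)$ maps one onto the other. In particular, if $X_1,\dots,X_\ell$ are all smooth, then $X_1\odot\cdots\odot X_\ell$ is smooth. -/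

import Mathlib

open MvPolynomial

noncomputable section

namespace HadamardVar

variable {K : Type*} [Field K]

/-- Projective `n`-space over `K`, with homogeneous coordinates `x_0, …, x_n`. -/
abbrev ProjSpace (K : Type*) [Field K] (n : ℕ) : Type _ :=
  Projectivization K (Fin (n + 1) → K)

/-- The common zeros in projective space of a set of polynomials (used for homogeneous ones, for
which vanishing does not depend on the representative of the point). -/
def projZeros {n : ℕ} (S : Set (MvPolynomial (Fin (n + 1)) K)) : Set (ProjSpace K n) :=
  {P | ∀ F ∈ S, eval P.rep F = 0}

/-- A subset of projective space is algebraic if it is the zero set of a family of homogeneous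
polynomials. -/
def IsAlgebraicSet {n : ℕ} (Z : Set (ProjSpace K n)) : Prop :=
  ∃ S : Set (MvPolynomial (Fin (n + 1)) K), (∀ F ∈ S, ∃ d, F.IsHomogeneous d) ∧ Z = projZeros S

theorem isAlgebraicSet_empty {n : ℕ} : IsAlgebraicSet (∅ : Set (ProjSpace K n)) := by
  refine ⟨{1}, ?_, ?_⟩
  · rintro F rfl
    exact ⟨0, isHomogeneous_one _ _⟩
  · ext P
    simp [projZeros]

theorem isAlgebraicSet_sInter {n : ℕ} (A : Set (Set (ProjSpace K n)))
    (hA : ∀ Z ∈ A, IsAlgebraicSet Z) : IsAlgebraicSet (⋂₀ A) := by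
  choose! S hS hZ using hA
  refine ⟨⋃ Z ∈ A, S Z, ?_, ?_⟩
  · intro F hF
    simp only [Set.mem_iUnion] at hF
    obtain ⟨Z, hZA, hF⟩ := hF
    exact hS Z hZA F hF
  · ext P
    simp only [Set.mem_sInter, projZeros, Set.mem_iUnion, Set.mem_ofPred_eq]
    constructor
    · rintro h F ⟨Z, hZA, hF⟩
      have hP := h Z hZA
      rw [hZ Z hZA] at hP
      exact hP F hF
    · intro h Z hZA
      rw [hZ Z hZA]
      exact fun F hF => h F ⟨Z, hZA, hF⟩

theorem isAlgebraicSet_union {n : ℕ} (A B : Set (ProjSpace K n))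
    (hA : IsAlgebraicSet A) (hB : IsAlgebraicSet B) : IsAlgebraicSet (A ∪ B) := by
  obtain ⟨S, hS, rfl⟩ := hA
  obtain ⟨T, hT, rfl⟩ := hB
  refine ⟨{F | ∃ G ∈ S, ∃ H ∈ T, F = G * H}, ?_, ?_⟩
  · rintro F ⟨G, hG, H, hH, rfl⟩
    obtain ⟨a, ha⟩ := hS G hG
    obtain ⟨b, hb⟩ := hT H hH
    exact ⟨a + b, ha.mul hb⟩
  · ext P
    simp only [projZeros, Set.mem_union, Set.mem_ofPred_eq]
    constructor
    · rintro (h | h) F ⟨G, hG, H, hH, rfl⟩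
      · simp [h G hG]
      · simp [h H hH]
    · intro h
      by_contra! hc
      obtain ⟨⟨G, hG, hG0⟩, ⟨H, hH, hH0⟩⟩ := hc
      have := h _ ⟨G, hG, H, hH, rfl⟩
      rw [map_mul] at this
      exact (mul_ne_zero hG0 hH0) this

/-- The Zariski topology: the closed sets are the algebraic sets. -/
instance zariskiTopology {n : ℕ} : TopologicalSpace (ProjSpace K n) :=
  TopologicalSpace.ofClosed {Z | IsAlgebraicSet Z} isAlgebraicSet_empty
    (fun A hA => isAlgebraicSet_sInter A hA)
    (fun A hA B hB => isAlgebraicSet_union A B hA hB)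

/-- A projective (sub)variety: a Zariski closed, irreducible (in particular nonempty) subset. -/
def IsVariety {n : ℕ} (X : Set (ProjSpace K n)) : Prop :=
  IsClosed X ∧ IsIrreducible X

/-! ### Hadamard products -/

/-- The closure of the set of all coordinatewise products `p ⋆ q`, `p ∈ X`, `q ∈ Y`, that are
defined, i.e. have a nonzero coordinate. -/
def hadamard {n : ℕ} (X Y : Set (ProjSpace K n)) : Set (ProjSpace K n) :=
  closure {R | ∃ (p q : Fin (n + 1) → K) (hp : p ≠ 0) (hq : q ≠ 0) (hpq : p * q ≠ 0),
    Projectivization.mk K p hp ∈ X ∧ Projectivization.mk K q hq ∈ Y ∧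
      R = Projectivization.mk K (p * q) hpq}

/-- The iterated Hadamard product `(⋯((X_0 ⋆ X_1) ⋆ X_2) ⋆ ⋯) ⋆ X_ℓ`. -/
def hadamardProd {n : ℕ} : (ℓ : ℕ) → (Fin (ℓ + 1) → Set (ProjSpace K n)) → Set (ProjSpace K n)
  | 0, X => X 0
  | ℓ + 1, X => hadamard (hadamardProd ℓ fun i => X i.castSucc) (X (Fin.last (ℓ + 1)))

/-! ### Linear subspaces and genericity -/

/-- Linear subspaces of dimension `h` of projective `n`-space, as `(h+1)`-dimensional vector
subspaces of `K^(n+1)`. -/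
def Grass (K : Type*) [Field K] (n h : ℕ) : Type _ :=
  {W : Submodule K (Fin (n + 1) → K) // Module.finrank K W = h + 1}

/-- The points of the linear subspace of projective space defined by a vector subspace. -/
def linearPoints {n : ℕ} (W : Submodule K (Fin (n + 1) → K)) : Set (ProjSpace K n) :=
  {P | P.submodule ≤ W}

/-- A tuple of matrices, the `i`-th of size `(n+1) × (h_i+1)`, as a point of affine space. -/
def flatten {m n : ℕ} {h : Fin m → ℕ}
    (A : ∀ i, Matrix (Fin (n + 1)) (Fin (h i + 1)) K) :
    (Σ i : Fin m, Fin (n + 1) × Fin (h i + 1)) → K :=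
  fun s => A s.1 s.2.1 s.2.2

/-- Zariski open subsets of the product of Grassmannians `∏ᵢ 𝔾(h_i, n)`. This product is the
quotient of the variety of tuples of matrices with linearly independent columns by column
operations (a tuple is sent to the column spaces), and a set is open iff its preimage among these
tuples is the complement of an affine algebraic set. -/
def IsOpenGrass {m n : ℕ} {h : Fin m → ℕ} (U : Set (∀ i, Grass K n (h i))) : Prop :=
  ∃ I : Ideal (MvPolynomial (Σ i : Fin m, Fin (n + 1) × Fin (h i + 1)) K),
    ∀ (A : ∀ i, Matrix (Fin (n + 1)) (Fin (h i + 1)) K) (L : ∀ i, Grass K n (h i)),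
      (∀ i, (L i).1 = LinearMap.range (A i).mulVecLin) →
        (L ∈ U ↔ flatten A ∉ zeroLocus K I)

/-! ### Product varieties -/

/-- The vector of all products `∏ᵢ y_i (J i)`, one for each multi-index `J`, placed in the
coordinates `e J`; the remaining coordinates are zero. -/
def segreVec {m n : ℕ} {h : Fin m → ℕ} (e : (∀ i, Fin (h i + 1)) ↪ Fin (n + 1))
    (y : ∀ i, Fin (h i + 1) → K) : Fin (n + 1) → K :=
  Function.extend e (fun J => ∏ i, y i (J i)) 0

theorem segreVec_ne_zero {m n : ℕ} {h : Fin m → ℕ} (e : (∀ i, Fin (h i + 1)) ↪ Fin (n + 1))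
    (y : ∀ i, Fin (h i + 1) → K) (hy : ∀ i, y i ≠ 0) : segreVec e y ≠ 0 := by
  have hJ : ∀ i, ∃ j, y i j ≠ 0 := fun i => Function.ne_iff.mp (hy i)
  choose J hJ using hJ
  refine Function.ne_iff.mpr ⟨e J, ?_⟩
  simp only [segreVec, e.injective.extend_apply, Pi.zero_apply]
  exact Finset.prod_ne_zero_iff.mpr fun i _ => hJ i

/-- The Segre embedding of `ℙ^{h_1} × ⋯ × ℙ^{h_m}` into `ℙ^n`, for `n + 1 ≥ ∏ (h_i + 1)`: the usual
Segre embedding followed by the inclusion of a coordinate subspace. -/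
def segre {m n : ℕ} {h : Fin m → ℕ} (e : (∀ i, Fin (h i + 1)) ↪ Fin (n + 1))
    (P : ∀ i, ProjSpace K (h i)) : ProjSpace K n :=
  Projectivization.mk K (segreVec e fun i => (P i).rep)
    (segreVec_ne_zero e _ fun i => (P i).rep_nonzero)

/-- The product variety `X_1 × ⋯ × X_m` as a subset of `ℙ^n`: each `X_i` is transported to
`ℙ^{h_i}` by the linear parametrization `φ_i : ℙ^{h_i} → ℙ^n` of a linear subspace containing it, and
the product is embedded by the Segre embedding. -/
def productVariety {m n : ℕ} {h : Fin m → ℕ} (e : (∀ i, Fin (h i + 1)) ↪ Fin (n + 1))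
    (φ : ∀ i, (Fin (h i + 1) → K) →ₗ[K] (Fin (n + 1) → K))
    (hφ : ∀ i, Function.Injective (φ i)) (X : Fin m → Set (ProjSpace K n)) :
    Set (ProjSpace K n) :=
  segre e '' {P | ∀ i, Projectivization.map (φ i) (hφ i) (P i) ∈ X i}

/-- Two subsets of `ℙ^n` are projectively equivalent if a projective automorphism of `ℙ^n` maps one
onto the other. -/
def ProjectivelyEquivalent {n : ℕ} (X Y : Set (ProjSpace K n)) : Prop :=
  ∃ g : (Fin (n + 1) → K) ≃ₗ[K] (Fin (n + 1) → K),
    Projectivization.map g.toLinearMap g.injective '' X = Y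

/-! ### Smoothness -/

/-- The homogeneous ideal of `X`, generated by the homogeneous polynomials vanishing on `X`. -/
def homogeneousIdeal {n : ℕ} (X : Set (ProjSpace K n)) : Ideal (MvPolynomial (Fin (n + 1)) K) :=
  Ideal.span {F | (∃ d, F.IsHomogeneous d) ∧ ∀ P ∈ X, eval P.rep F = 0}

/-- The vector subspace of `K^(n+1)` of the embedded projective tangent space to `X` at the point
`[v]`: the kernel of the Jacobian matrix, at `v`, of the homogeneous ideal of `X`. -/
def tangentSpace {n : ℕ} (X : Set (ProjSpace K n)) (v : Fin (n + 1) → K) :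
    Submodule K (Fin (n + 1) → K) where
  carrier := {w | ∀ F ∈ homogeneousIdeal X, ∑ j, eval v (pderiv j F) * w j = 0}
  zero_mem' := by simp
  add_mem' := by
    intro a b ha hb F hF
    simp [mul_add, Finset.sum_add_distrib, ha F hF, hb F hF]
  smul_mem' := by
    intro c a ha F hF
    simp only [Pi.smul_apply, smul_eq_mul, mul_left_comm _ c, ← Finset.mul_sum, ha F hF, mul_zero]

/-- A variety `X` is smooth if at each of its points the projective tangent space has dimension
`dim X`. Both sides below are one more than these dimensions: the tangent space is represented by a
vector space, and `dim X + 1` is the Krull dimension of the homogeneous coordinate ring of `X`. -/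
def IsSmooth {n : ℕ} (X : Set (ProjSpace K n)) : Prop :=
  ∀ (v : Fin (n + 1) → K) (hv : v ≠ 0), Projectivization.mk K v hv ∈ X →
    (Module.finrank K (tangentSpace X v) : WithBot ℕ∞) =
      ringKrullDim (MvPolynomial (Fin (n + 1)) K ⧸ homogeneousIdeal X)

end HadamardVar

end

open MvPolynomial

noncomputable section

namespace HadamardVar

section CommAlg

open TensorProduct KaehlerDifferential

/-! ### Krull dimension and derivations of finitely generated domains -/

/-! Coordinatewise multiplication is multilinear, so on `L_1 × ⋯ × L_ℓ` it is the Segre map followed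
by a linear map `⊗ L_i → K^(n+1)`. If that linear map is injective, it extends to an automorphism
comparing the set of products with the Segre product. Injectivity means that the subspace `∏ L_i` of
the algebra `K^(n+1)` has dimension `∏ (h_i + 1)`. This is the genericity condition: it is the
nonvanishing of some maximal minor of `productMatrix`, and 0/1 matrices satisfy it when `n + 1 ≥ ∏
(h_i + 1)`.

The geometric properties are proved two factors at a time, for `X ⊆ ℙ(V)` and `Y ⊆ ℙ(W)` with `V`,
`W` linearly disjoint. A left inverse of `V ⊗ W → K^(n+1)` followed by contraction gives linear maps
recovering `p` and `q` from `p * q` up to scalars (`exists_leftFactor`). Hence the products already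
form a closed set, with explicit equations, so that no closure is needed (`isClosed_productPoints`);
irreducibility is the usual slicing argument.

Differentiating the same equations gives `T_{pq} = T_p · q + p · T_q`, a sum whose two terms meet in
the line through `p * q`. If `X` and `Y` are smooth, the tangent dimension is therefore constant on
the product. In characteristic zero it equals the dimension at some point
(`exists_finrank_tangentSpace_eq_ringKrullDim`), hence everywhere; the dimension of the product is
never computed. -/

theorem ringKrullDim_eq_of_isIntegral {A B : Type*} [CommRing A] [CommRing B] [Algebra A B]
    [Algebra.IsIntegral A B] [FaithfulSMul A B] : ringKrullDim B = ringKrullDim A := by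
  apply le_antisymm
  -- Incomparability gives one inequality; lying over and going up give the other.
  · exact Order.krullDim_le_of_strictMono (PrimeSpectrum.comap (algebraMap A B))
      fun P Q h => Ideal.IsIntegral.comap_lt_comap (I := P.asIdeal) (J := Q.asIdeal) h
  · refine iSup_le fun p => ?_
    obtain ⟨P, hP⟩ := Ideal.nonempty_primesOver (S := B) p.head.asIdeal
    have := hP.1
    have := hP.2
    obtain ⟨q, hq, -⟩ := Ideal.exists_ltSeries_of_hasGoingUp p P
    rw [← hq]
    exact le_iSup (fun q : LTSeries (PrimeSpectrum B) => (q.length : WithBot ℕ∞)) q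

theorem finrank_derivation_eq (K : Type*) {R : Type*} [Field K] [CommRing R] [Algebra K R]
    (L : Type*) [Field L] [Algebra R L] [Algebra K L] [IsScalarTower K R L]
    [Module.Finite R Ω[R⁄K]] :
    Module.finrank L (Derivation K R L) = Module.finrank L (L ⊗[R] Ω[R⁄K]) := by
  let e : (Ω[R⁄K] →ₗ[R] L) ≃ₗ[L] Derivation K R L :=
    { linearMapEquivDerivation K R with
      map_smul' := fun c f => by ext; simp }
  rw [← e.finrank_eq, (LinearMap.liftBaseChangeEquiv L).finrank_eq]
  exact Subspace.dual_finrank_eq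

/-- The map `R → L` factors through the localization at `g`, where `M` is free, so every such fibre
has the same rank. -/
theorem finrank_tensorProduct_eq_of_free_away {R M : Type*} [CommRing R] [AddCommGroup M]
    [Module R M] (g : R) [Module.Free (Localization (.powers g)) (LocalizedModule.Away g M)]
    (L : Type*) [Field L] [Algebra R L] (hg : algebraMap R L g ≠ 0) :
    Module.finrank L (L ⊗[R] M) =
      Module.finrank (Localization (.powers g)) (LocalizedModule.Away g M) := by
  let f : Localization (.powers g) →+* L := IsLocalization.Away.lift g (isUnit_iff_ne_zero.mpr hg)
  let := f.toAlgebra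
  have : IsScalarTower R (Localization (.powers g)) L :=
    .of_algebraMap_eq fun x => (IsLocalization.Away.lift_eq g (isUnit_iff_ne_zero.mpr hg) x).symm
  let e₁ := (IsLocalizedModule.isBaseChange (.powers g) (Localization (.powers g))
    (LocalizedModule.mkLinearMap (.powers g) M)).equiv
  let e₂ := TensorProduct.AlgebraTensorModule.cancelBaseChange R (Localization (.powers g)) L L M
  have : Module.Free (Localization (.powers g)) (Localization (.powers g) ⊗[R] M) :=
    .of_equiv e₁.symm
  have : Nontrivial (Localization (.powers g)) := f.domain_nontrivial
  rw [← e₂.finrank_eq, Module.finrank_baseChange, e₁.finrank_eq]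

/-- Generic smoothness. By Noether normalization `R` is finite over a polynomial ring in `s = dim R`
variables, and in characteristic zero the extension of fraction fields is separable, so the
differentials have generic rank `s`. Being finitely presented, they are free of that rank away from
some `g = 0`. -/
theorem exists_finrank_derivation_eq_ringKrullDim (K R : Type*) [Field K] [CharZero K] [CommRing R]
    [IsDomain R] [Algebra K R] [Algebra.FiniteType K R] :
    ∃ g : R, g ≠ 0 ∧ ∀ (L : Type*) [Field L] [Algebra R L] [Algebra K L] [IsScalarTower K R L],
      algebraMap R L g ≠ 0 →
        (Module.finrank L (Derivation K R L) : WithBot ℕ∞) = ringKrullDim R := by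
  obtain ⟨s, f, hf, hfin⟩ := exists_finite_inj_algHom_of_fg K R
  let := f.toRingHom.toAlgebra
  have : IsScalarTower K (MvPolynomial (Fin s) K) R := .of_algHom f
  have : Module.Finite (MvPolynomial (Fin s) K) R := hfin
  have : FaithfulSMul (MvPolynomial (Fin s) K) R :=
    (faithfulSMul_iff_algebraMap_injective _ _).mpr hf
  have hdim : ringKrullDim R = s := by
    rw [ringKrullDim_eq_of_isIntegral (A := MvPolynomial (Fin s) K),
      MvPolynomial.ringKrullDim_of_isNoetherianRing, ringKrullDim_eq_zero_of_field]
    simp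
  let F := FractionRing R
  let E := FractionRing (MvPolynomial (Fin s) K)
  let _ : Algebra E F := FractionRing.liftAlgebra _ _
  have : IsScalarTower (MvPolynomial (Fin s) K) E F := inferInstance
  have : Algebra.IsAlgebraic E F := inferInstance
  have : CharZero E := inferInstance
  have : Algebra.FormallyEtale E F := Algebra.FormallyEtale.of_isSeparable E F
  have : Algebra.FormallyEtale (MvPolynomial (Fin s) K) E :=
    .of_isLocalization (nonZeroDivisors (MvPolynomial (Fin s) K))
  have : Algebra.FormallyEtale (MvPolynomial (Fin s) K) F := .comp _ E F
  have hrank : Module.finrank F Ω[F⁄K] = s := by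
    have e := tensorKaehlerEquivOfFormallyEtale K (MvPolynomial (Fin s) K) F
    rw [← e.finrank_eq, Module.finrank_baseChange,
      Module.finrank_eq_card_basis (mvPolynomialBasis K (Fin s)), Fintype.card_fin]
  have : IsNoetherianRing R := Algebra.FiniteType.isNoetherianRing K R
  have : Module.FinitePresentation R Ω[R⁄K] := Module.finitePresentation_of_finite R _
  obtain ⟨g, hg, hfree, hgrank⟩ := Module.FinitePresentation.exists_free_localizedModule_powers
    (nonZeroDivisors R) (KaehlerDifferential.map K K R F) F
  refine ⟨g, nonZeroDivisors.ne_zero hg, fun L _ _ _ _ hgL => ?_⟩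
  rw [finrank_derivation_eq, finrank_tensorProduct_eq_of_free_away g L hgL, hgrank, hrank, hdim]

end CommAlg

/-! ### Homogeneous polynomials, their zeros and their differentials -/

section Homogeneous

variable {K : Type*} [Field K] {n : ℕ}

theorem eval_smul_of_isHomogeneous {σ : Type*} {F : MvPolynomial σ K} {d : ℕ}
    (hF : F.IsHomogeneous d) (c : K) (v : σ → K) : eval (c • v) F = c ^ d * eval v F := by
  rw [eval_eq, eval_eq, Finset.mul_sum]
  refine Finset.sum_congr rfl fun s hs => ?_
  have hd : ∑ i ∈ s.support, s i = d := by
    rw [← hF.degree_eq_sum_deg_support hs]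
  simp only [Pi.smul_apply, smul_eq_mul, mul_pow, Finset.prod_mul_distrib,
    Finset.prod_pow_eq_pow_sum, hd]
  ring

theorem eval_rep_mk_eq_zero_iff {F : MvPolynomial (Fin (n + 1)) K} {d : ℕ} (hF : F.IsHomogeneous d)
    {v : Fin (n + 1) → K} (hv : v ≠ 0) :
    eval (Projectivization.mk K v hv).rep F = 0 ↔ eval v F = 0 := by
  obtain ⟨a, ha⟩ := Projectivization.exists_smul_eq_mk_rep K v hv
  rw [← ha, Units.smul_def, eval_smul_of_isHomogeneous hF]
  simp

theorem mk_mem_projZeros_iff {S : Set (MvPolynomial (Fin (n + 1)) K)}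
    (hS : ∀ F ∈ S, ∃ d, F.IsHomogeneous d) {v : Fin (n + 1) → K} (hv : v ≠ 0) :
    Projectivization.mk K v hv ∈ projZeros S ↔ ∀ F ∈ S, eval v F = 0 := by
  refine forall₂_congr fun F hF => ?_
  obtain ⟨d, hd⟩ := hS F hF
  exact eval_rep_mk_eq_zero_iff hd hv

theorem isClosed_iff_isAlgebraicSet {Z : Set (ProjSpace K n)} :
    IsClosed Z ↔ IsAlgebraicSet Z := by
  rw [← isOpen_compl_iff]
  change IsAlgebraicSet Zᶜᶜ ↔ _
  rw [compl_compl]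

/-- The homogeneous polynomials vanishing on a set of points. -/
def vanishingForms (X : Set (ProjSpace K n)) : Set (MvPolynomial (Fin (n + 1)) K) :=
  {F | (∃ d, F.IsHomogeneous d) ∧ ∀ P ∈ X, eval P.rep F = 0}

theorem mem_vanishingForms_iff {X : Set (ProjSpace K n)} {F : MvPolynomial (Fin (n + 1)) K} :
    F ∈ vanishingForms X ↔ (∃ d, F.IsHomogeneous d) ∧
      ∀ (v : Fin (n + 1) → K) (hv : v ≠ 0), Projectivization.mk K v hv ∈ X → eval v F = 0 := by
  refine and_congr_right fun ⟨d, hd⟩ => ⟨fun h v hv hX => ?_, fun h P hP => ?_⟩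
  · exact (eval_rep_mk_eq_zero_iff hd hv).mp (h _ hX)
  · exact h _ P.rep_nonzero (by rwa [P.mk_rep])

theorem isClosed_projZeros {S : Set (MvPolynomial (Fin (n + 1)) K)}
    (hS : ∀ F ∈ S, ∃ d, F.IsHomogeneous d) : IsClosed (projZeros S) :=
  isClosed_iff_isAlgebraicSet.mpr ⟨S, hS, rfl⟩

theorem mk_mem_iff_of_isClosed {X : Set (ProjSpace K n)} (hX : IsClosed X)
    {v : Fin (n + 1) → K} (hv : v ≠ 0) :
    Projectivization.mk K v hv ∈ X ↔ ∀ F ∈ vanishingForms X, eval v F = 0 := by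
  refine ⟨fun h F hF => (mem_vanishingForms_iff.mp hF).2 v hv h, fun h => ?_⟩
  obtain ⟨S, hS, rfl⟩ := isClosed_iff_isAlgebraicSet.mp hX
  rw [mk_mem_projZeros_iff hS]
  exact fun F hF => h F ⟨hS F hF, fun P hP => hP F hF⟩

theorem mem_homogeneousIdeal_iff_of_isHomogeneous {X : Set (ProjSpace K n)}
    {F : MvPolynomial (Fin (n + 1)) K} {d : ℕ} (hF : F.IsHomogeneous d) :
    F ∈ homogeneousIdeal X ↔ ∀ P ∈ X, eval P.rep F = 0 := by
  refine ⟨fun h P hP => ?_, fun h => Ideal.subset_span ⟨⟨d, hF⟩, h⟩⟩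
  have : homogeneousIdeal X ≤ RingHom.ker (eval P.rep) :=
    Ideal.span_le.mpr fun G hG => hG.2 P hP
  exact this h

theorem eval_eq_zero_of_mem_homogeneousIdeal {X : Set (ProjSpace K n)}
    {F : MvPolynomial (Fin (n + 1)) K} (hF : F ∈ homogeneousIdeal X) {v : Fin (n + 1) → K}
    (hv : v ≠ 0) (hX : Projectivization.mk K v hv ∈ X) : eval v F = 0 := by
  have : homogeneousIdeal X ≤ RingHom.ker (eval v) :=
    Ideal.span_le.mpr fun G hG => (mem_vanishingForms_iff.mp hG).2 v hv hX
  exact this hF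

theorem isPrime_homogeneousIdeal {X : Set (ProjSpace K n)} (hX : IsIrreducible X) :
    (homogeneousIdeal X).IsPrime := by
  let _ : GradedAlgebra (homogeneousSubmodule (Fin (n + 1)) K) := MvPolynomial.gradedAlgebra
  have hhom : (homogeneousIdeal X).IsHomogeneous (homogeneousSubmodule (Fin (n + 1)) K) :=
    Ideal.homogeneous_span _ _ fun _ hF => hF.1
  -- Primality of a homogeneous ideal need only be tested on forms, and each form cuts out a closed
  -- set to which irreducibility applies.
  refine hhom.isPrime_of_homogeneous_mem_or_mem ?_ ?_
  · rw [Ideal.ne_top_iff_one, mem_homogeneousIdeal_iff_of_isHomogeneous (isHomogeneous_one _ _)]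
    obtain ⟨P, hP⟩ := hX.1
    exact fun h => by simpa using h P hP
  · rintro F G ⟨a, ha⟩ ⟨b, hb⟩ hFG
    rw [mem_homogeneousSubmodule] at ha hb
    rw [mem_homogeneousIdeal_iff_of_isHomogeneous (ha.mul hb)] at hFG
    rw [mem_homogeneousIdeal_iff_of_isHomogeneous ha, mem_homogeneousIdeal_iff_of_isHomogeneous hb]
    have hcl : ∀ {H : MvPolynomial (Fin (n + 1)) K} {d : ℕ}, H.IsHomogeneous d →
        IsClosed (projZeros {H}) := fun hH => isClosed_projZeros (by rintro _ rfl; exact ⟨_, hH⟩)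
    rcases (isPreirreducible_iff_isClosed_union_isClosed.mp hX.2 _ _ (hcl ha) (hcl hb) (by
      intro P hP
      simpa [projZeros] using hFG P hP)) with h | h
    · exact .inl fun P hP => by simpa [projZeros] using h hP
    · exact .inr fun P hP => by simpa [projZeros] using h hP

theorem exists_eval_ne_zero_of_notMem_homogeneousIdeal [Infinite K] {X : Set (ProjSpace K n)}
    {G : MvPolynomial (Fin (n + 1)) K} (hG : G ∉ homogeneousIdeal X) :
    ∃ (v : Fin (n + 1) → K) (hv : v ≠ 0), Projectivization.mk K v hv ∈ X ∧ eval v G ≠ 0 := by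
  obtain ⟨d, hd⟩ : ∃ d, homogeneousComponent d G ∉ homogeneousIdeal X := by
    by_contra! h
    exact hG ((sum_homogeneousComponent G) ▸ Ideal.sum_mem _ fun i _ => h i)
  rw [mem_homogeneousIdeal_iff_of_isHomogeneous (homogeneousComponent_isHomogeneous d G)] at hd
  push Not at hd
  obtain ⟨P, hP, hPd⟩ := hd
  by_contra! hzero
  -- `p(t) = G(t • P.rep)`, whose coefficients are the values of the homogeneous components at `P`.
  -- The vector at `t = 0` gives no projective point, so `X * p` is shown to vanish instead of `p`.
  let p : Polynomial K := ∑ i ∈ Finset.range (G.totalDegree + 1),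
    Polynomial.C (eval P.rep (homogeneousComponent i G)) * Polynomial.X ^ i
  have hp : Polynomial.X * p = 0 := by
    refine Polynomial.funext fun t => ?_
    rcases eq_or_ne t 0 with rfl | ht
    · simp
    have hpt : p.eval t = eval (t • P.rep) G := by
      rw [← congrArg (eval (t • P.rep)) (sum_homogeneousComponent G)]
      rw [eval_sum, Polynomial.eval_finsetSum]
      refine Finset.sum_congr rfl fun i _ => ?_
      rw [eval_smul_of_isHomogeneous (homogeneousComponent_isHomogeneous i G)]
      rw [Polynomial.eval_mul, Polynomial.eval_C, Polynomial.eval_pow, Polynomial.eval_X, mul_comm]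
    have hne : t • P.rep ≠ 0 := smul_ne_zero ht P.rep_nonzero
    have hmk : Projectivization.mk K (t • P.rep) hne = P := by
      refine Eq.trans ?_ P.mk_rep
      exact (Projectivization.mk_eq_mk_iff' K _ _ _ _).mpr ⟨t, rfl⟩
    simp [hpt, hzero _ hne (by rwa [hmk])]
  have hcoeff : p.coeff d = eval P.rep (homogeneousComponent d G) := by
    simp only [p, Polynomial.finsetSum_coeff, Polynomial.coeff_C_mul_X_pow]
    rw [Finset.sum_ite_eq]
    split_ifs with h
    · rfl
    · rw [homogeneousComponent_eq_zero _ _ (by simpa using h), map_zero]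
  rw [mul_eq_zero_iff_left Polynomial.X_ne_zero] at hp
  rw [hp] at hcoeff
  exact hPd (by simpa using hcoeff.symm)

/-- The differential at `v` of a polynomial, evaluated at `w`. -/
def differential {σ : Type*} [Fintype σ] (F : MvPolynomial σ K) (v w : σ → K) : K :=
  ∑ j, eval v (pderiv j F) * w j

theorem differential_mul {σ : Type*} [Fintype σ] (F G : MvPolynomial σ K) (v w : σ → K) :
    differential (F * G) v w = eval v F * differential G v w + eval v G * differential F v w := by
  simp only [differential, Derivation.leibniz, smul_eq_mul, map_add, map_mul, add_mul,
    Finset.sum_add_distrib, Finset.mul_sum, mul_assoc]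

theorem differential_add {σ : Type*} [Fintype σ] (F G : MvPolynomial σ K) (v w : σ → K) :
    differential (F + G) v w = differential F v w + differential G v w := by
  simp only [differential, map_add, add_mul, Finset.sum_add_distrib]

theorem differential_sub {σ : Type*} [Fintype σ] (F G : MvPolynomial σ K) (v w : σ → K) :
    differential (F - G) v w = differential F v w - differential G v w := by
  simp only [differential, map_sub, sub_mul, Finset.sum_sub_distrib]

theorem differential_C {σ : Type*} [Fintype σ] (c : K) (v w : σ → K) :
    differential (C c) v w = 0 := by
  simp [differential]

theorem differential_X {σ : Type*} [Fintype σ] (i : σ) (v w : σ → K) :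
    differential (X i) v w = w i := by
  classical
  simp [differential, pderiv_X, Pi.single_apply, apply_ite]

theorem differential_self {σ : Type*} [Fintype σ] {F : MvPolynomial σ K} {d : ℕ}
    (hF : F.IsHomogeneous d) (v : σ → K) : differential F v v = d * eval v F := by
  have := congrArg (eval v) hF.sum_X_mul_pderiv
  simpa [differential, mul_comm] using this

theorem differential_smul_eq_zero_iff {σ : Type*} [Fintype σ] {F : MvPolynomial σ K} {d : ℕ}
    (hF : F.IsHomogeneous d) {c : K} (hc : c ≠ 0) (v w : σ → K) :
    differential F (c • v) w = 0 ↔ differential F v w = 0 := by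
  have : differential F (c • v) w = c ^ (d - 1) * differential F v w := by
    simp only [differential, Finset.mul_sum]
    refine Finset.sum_congr rfl fun j _ => ?_
    rw [eval_smul_of_isHomogeneous hF.pderiv, mul_assoc]
  simp [this, hc]

/-- The linear form on `K^σ` given by `φ`, as a polynomial. -/
def linForm {σ : Type*} [Fintype σ] [DecidableEq σ] (φ : (σ → K) →ₗ[K] K) : MvPolynomial σ K :=
  ∑ j, C (φ (Pi.single j 1)) * X j

section

variable {σ : Type*} [Fintype σ] [DecidableEq σ]

theorem linForm_isHomogeneous (φ : (σ → K) →ₗ[K] K) : (linForm φ).IsHomogeneous 1 :=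
  .sum _ _ _ fun j _ => isHomogeneous_C_mul_X _ j

theorem sum_apply_single_mul (φ : (σ → K) →ₗ[K] K) (v : σ → K) :
    ∑ j, φ (Pi.single j 1) * v j = φ v := by
  conv_rhs => rw [pi_eq_sum_univ' v]
  simp [mul_comm]

theorem eval_linForm (φ : (σ → K) →ₗ[K] K) (v : σ → K) : eval v (linForm φ) = φ v := by
  simp [linForm, sum_apply_single_mul]

theorem differential_linForm (φ : (σ → K) →ₗ[K] K) (v w : σ → K) :
    differential (linForm φ) v w = φ w := by
  rw [← sum_apply_single_mul φ w]
  simp [differential, linForm, pderiv_X, Pi.single_apply]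

/-- The composition of a polynomial with a linear map. -/
def compLinear {τ : Type*} (T : (σ → K) →ₗ[K] (τ → K)) (F : MvPolynomial τ K) : MvPolynomial σ K :=
  aeval (fun i => linForm (LinearMap.proj i ∘ₗ T)) F

theorem compLinear_isHomogeneous {τ : Type*} (T : (σ → K) →ₗ[K] (τ → K)) {F : MvPolynomial τ K}
    {d : ℕ} (hF : F.IsHomogeneous d) : (compLinear T F).IsHomogeneous d := by
  have := hF.aeval (fun i => linForm (LinearMap.proj i ∘ₗ T)) (n := 1)
    fun i => linForm_isHomogeneous _
  rwa [one_mul] at this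

theorem eval_compLinear {τ : Type*} (T : (σ → K) →ₗ[K] (τ → K)) (F : MvPolynomial τ K)
    (v : σ → K) : eval v (compLinear T F) = eval (T v) F := by
  induction F using MvPolynomial.induction_on with
  | C a => simp [compLinear]
  | add p q hp hq => simp_all [compLinear]
  | mul_X p i hp => simp_all [compLinear, eval_linForm]

theorem differential_compLinear {τ : Type*} [Fintype τ] (T : (σ → K) →ₗ[K] (τ → K))
    (F : MvPolynomial τ K) (v w : σ → K) :
    differential (compLinear T F) v w = differential F (T v) (T w) := by
  induction F using MvPolynomial.induction_on with
  | C a => simp [compLinear, differential_C]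
  | add p q hp hq =>
    simp only [compLinear, map_add, differential_add] at *
    rw [hp, hq]
  | mul_X p i hp =>
    have := eval_compLinear T p v
    simp only [compLinear, map_mul, aeval_X, differential_mul, differential_linForm, eval_linForm,
      differential_X, eval_X] at *
    rw [hp, this]
    simp

end

end Homogeneous

/-! ### Tangent spaces -/

section Tangent

variable {K : Type*} [Field K] {n : ℕ}

/-- By the Leibniz rule, at a point where the ideal vanishes only its generators impose conditions.
-/
theorem mem_tangentSpace_iff {X : Set (ProjSpace K n)} {v w : Fin (n + 1) → K} (hv : v ≠ 0)
    (hX : Projectivization.mk K v hv ∈ X) :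
    w ∈ tangentSpace X v ↔ ∀ F ∈ vanishingForms X, differential F v w = 0 := by
  refine ⟨fun h F hF => h F (Ideal.subset_span hF), fun h F hF => ?_⟩
  change differential F v w = 0
  induction hF using Submodule.span_induction with
  | mem F hF => exact h F hF
  | zero => simp [differential]
  | add F G _ _ hF hG => rw [differential_add, hF, hG, add_zero]
  | smul G F hF' hF =>
    rw [smul_eq_mul, differential_mul, hF, eval_eq_zero_of_mem_homogeneousIdeal hF' hv hX]
    simp

theorem self_mem_tangentSpace {X : Set (ProjSpace K n)} {v : Fin (n + 1) → K} (hv : v ≠ 0)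
    (hX : Projectivization.mk K v hv ∈ X) : v ∈ tangentSpace X v := by
  rw [mem_tangentSpace_iff hv hX]
  intro F hF
  obtain ⟨⟨d, hd⟩, hF⟩ := mem_vanishingForms_iff.mp hF
  rw [differential_self hd, hF v hv hX, mul_zero]

theorem mk_mem_linearPoints {W : Submodule K (Fin (n + 1) → K)} {v : Fin (n + 1) → K}
    (hv : v ≠ 0) : Projectivization.mk K v hv ∈ linearPoints W ↔ v ∈ W := by
  simp [linearPoints, Projectivization.submodule_mk]

theorem linForm_mem_vanishingForms {X : Set (ProjSpace K n)} {W : Submodule K (Fin (n + 1) → K)}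
    (hX : X ⊆ linearPoints W) {φ : (Fin (n + 1) → K) →ₗ[K] K} (hφ : φ ∈ W.dualAnnihilator) :
    linForm φ ∈ vanishingForms X := by
  refine mem_vanishingForms_iff.mpr ⟨⟨1, linForm_isHomogeneous φ⟩, fun v hv hvX => ?_⟩
  rw [eval_linForm]
  exact (Submodule.mem_dualAnnihilator φ).mp hφ v ((mk_mem_linearPoints hv).mp (hX hvX))

theorem tangentSpace_le {X : Set (ProjSpace K n)} {W : Submodule K (Fin (n + 1) → K)}
    (hX : X ⊆ linearPoints W) (v : Fin (n + 1) → K) : tangentSpace X v ≤ W := by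
  intro w hw
  rw [← Subspace.forall_mem_dualAnnihilator_apply_eq_zero_iff]
  intro φ hφ
  rw [← differential_linForm φ v w]
  exact hw _ (Ideal.subset_span (linForm_mem_vanishingForms hX hφ))

/-- Tangent vectors at `v` are the derivations of the homogeneous coordinate ring into `K`, regarded
as a module by evaluation at `v`. It remains to choose `v` on the cone over `X` off the bad locus `g
= 0`. -/
theorem exists_finrank_tangentSpace_eq_ringKrullDim [CharZero K] {X : Set (ProjSpace K n)}
    (hX : IsIrreducible X) :
    ∃ (v : Fin (n + 1) → K) (hv : v ≠ 0), Projectivization.mk K v hv ∈ X ∧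
      (Module.finrank K (tangentSpace X v) : WithBot ℕ∞) =
        ringKrullDim (MvPolynomial (Fin (n + 1)) K ⧸ homogeneousIdeal X) := by
  have := isPrime_homogeneousIdeal hX
  obtain ⟨g, hg, hgL⟩ := exists_finrank_derivation_eq_ringKrullDim K
    (MvPolynomial (Fin (n + 1)) K ⧸ homogeneousIdeal X)
  obtain ⟨G, rfl⟩ := Ideal.Quotient.mk_surjective g
  rw [Ne, Ideal.Quotient.eq_zero_iff_mem] at hg
  obtain ⟨v, hv, hvX, hGv⟩ := exists_eval_ne_zero_of_notMem_homogeneousIdeal hg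
  refine ⟨v, hv, hvX, ?_⟩
  let f : (MvPolynomial (Fin (n + 1)) K ⧸ homogeneousIdeal X) →ₐ[K] K :=
    Ideal.Quotient.liftₐ _ (aeval v) fun F hF => eval_eq_zero_of_mem_homogeneousIdeal hF hv hvX
  let _ : Algebra (MvPolynomial (Fin (n + 1)) K ⧸ homogeneousIdeal X) K := f.toRingHom.toAlgebra
  have hsmul : ∀ (F : MvPolynomial (Fin (n + 1)) K) (c : K),
      Ideal.Quotient.mk (homogeneousIdeal X) F • c = eval v F * c := fun F c => rfl
  have : IsScalarTower K (MvPolynomial (Fin (n + 1)) K ⧸ homogeneousIdeal X) K :=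
    .of_algHom f
  rw [← hgL K hGv]
  congr 1
  let Φ : Derivation K (MvPolynomial (Fin (n + 1)) K ⧸ homogeneousIdeal X) K →ₗ[K]
      (Fin (n + 1) → K) :=
    { toFun := fun D j => D (Ideal.Quotient.mk _ (MvPolynomial.X j))
      map_add' := fun D D' => rfl
      map_smul' := fun c D => rfl }
  have hΦ : ∀ D F, D (Ideal.Quotient.mk _ F) = differential F v (Φ D) := by
    intro D F
    induction F using MvPolynomial.induction_on with
    | C a =>
      rw [differential_C]
      exact D.map_algebraMap a
    | add p q hp hq => rw [map_add, map_add, hp, hq, differential_add]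
    | mul_X p i hp =>
      rw [map_mul, D.leibniz, hp, differential_mul, differential_X, eval_X, hsmul, hsmul, eval_X]
      rfl
  have hinj : Function.Injective Φ := by
    intro D D' h
    ext x
    obtain ⟨F, rfl⟩ := Ideal.Quotient.mk_surjective x
    rw [hΦ, hΦ, h]
  have hrange : LinearMap.range Φ = tangentSpace X v := by
    ext w
    constructor
    · rintro ⟨D, rfl⟩ F hF
      change differential F v (Φ D) = 0
      rw [← hΦ, Ideal.Quotient.eq_zero_iff_mem.mpr hF, map_zero]
    · intro hw
      let δ : MvPolynomial (Fin (n + 1)) K →ₗ[K] K :=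
        { toFun := fun F => differential F v w
          map_add' := fun F G => differential_add F G v w
          map_smul' := fun c F => by simp [smul_eq_C_mul, differential_mul, differential_C] }
      let δ' : (MvPolynomial (Fin (n + 1)) K ⧸ homogeneousIdeal X) →ₗ[K] K :=
        Submodule.liftQ ((homogeneousIdeal X).restrictScalars K) δ fun F hF => hw F hF
      refine ⟨Derivation.mk' δ' ?_, ?_⟩
      · intro a b
        obtain ⟨F, rfl⟩ := Ideal.Quotient.mk_surjective a
        obtain ⟨G, rfl⟩ := Ideal.Quotient.mk_surjective b
        exact differential_mul F G v w
      · ext j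
        exact differential_X j v w
  rw [← hrange, LinearMap.finrank_range_of_inj hinj]

end Tangent

/-! ### Hadamard products of two varieties in linearly disjoint linear subspaces -/

section TwoFactors

variable {K : Type*} [Field K] {n : ℕ}

open TensorProduct in
/-- If `V` and `W` are linearly disjoint, the two factors of a product `p * q` can be recovered, up
to scalars, by linear maps. -/
theorem exists_leftFactor {V W : Submodule K (Fin (n + 1) → K)} (hVW : V.LinearDisjoint W) :
    ∃ T : ((Fin (n + 1) → K) →ₗ[K] K) → (Fin (n + 1) → K) →ₗ[K] (Fin (n + 1) → K),
      (∀ g r, T g r ∈ V) ∧ (∀ g, ∀ p ∈ V, ∀ q ∈ W, T g (p * q) = g q • p) ∧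
      ∀ r ∈ V * W, r ≠ 0 → ∃ g, T g r ≠ 0 := by
  obtain ⟨ν, hν⟩ := LinearMap.exists_leftInverse_of_injective (V := V ⊗[K] W)
    (V' := Fin (n + 1) → K) (V.mulMap W)
    ((LinearMap.ker_eq_bot (M := V ⊗[K] W)).mpr hVW.injective)
  have hν' : ∀ t, ν (Submodule.mulMap V W t) = t := fun t => LinearMap.congr_fun hν t
  let c : ((Fin (n + 1) → K) →ₗ[K] K) → (V ⊗[K] W →ₗ[K] V) := fun g =>
    -- `c g` contracts the second tensor factor with `g`, and `T g` does so after lifting a vector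
    -- to `V ⊗ W`.
    (TensorProduct.rid K V).toLinearMap ∘ₗ (g ∘ₗ W.subtype).lTensor V
  refine ⟨fun g => V.subtype ∘ₗ c g ∘ₗ ν, fun g r => (c g (ν r)).2, ?_, ?_⟩
  · intro g p hp q hq
    have : ν (p * q) = (⟨p, hp⟩ : V) ⊗ₜ (⟨q, hq⟩ : W) := hν' ((⟨p, hp⟩ : V) ⊗ₜ (⟨q, hq⟩ : W))
    simp [this, c]
  · intro r hr hr0
    rw [← Submodule.mulMap_range] at hr
    obtain ⟨t, rfl⟩ := hr
    by_contra! h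
    refine hr0 ?_
    suffices t = 0 by rw [this, map_zero]
    let bV := Module.finBasis K V
    let bW := Module.finBasis K W
    -- The `(i, j)` coordinate of `t` is the `i`-th coordinate of its contraction with the `j`-th
    -- dual basis vector, so a tensor killed by all contractions is zero.
    refine (bV.tensorProduct bW).ext_elem fun ⟨i, j⟩ => ?_
    obtain ⟨g, hg⟩ := LinearMap.exists_extend (bW.coord j)
    have key : ∀ t, (bV.tensorProduct bW).repr t (i, j) = bV.repr (c g t) i := by
      intro t
      induction t with
      | zero => simp
      | add x y hx hy => simp [hx, hy]
      | tmul x y => simp [c, hg, mul_comm]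
    have h0 : c g t = 0 := by
      have := h g
      rw [LinearMap.comp_apply, LinearMap.comp_apply, hν'] at this
      exact Subtype.ext this
    simp [key, h0]

theorem mul_ne_zero_of_linearDisjoint {V W : Submodule K (Fin (n + 1) → K)}
    (hVW : V.LinearDisjoint W) {p q : Fin (n + 1) → K} (hp : p ∈ V) (hq : q ∈ W) (hp0 : p ≠ 0)
    (hq0 : q ≠ 0) : p * q ≠ 0 := by
  obtain ⟨T, -, hT, -⟩ := exists_leftFactor hVW
  obtain ⟨i, hi⟩ := Function.ne_iff.mp hq0
  intro h
  have := hT (LinearMap.proj i) p hp q hq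
  rw [h, map_zero] at this
  exact smul_ne_zero hi hp0 this.symm

/-- The set of the products `p * q`, whose closure is the Hadamard product. -/
def productPoints (X Y : Set (ProjSpace K n)) : Set (ProjSpace K n) :=
  {R | ∃ (p q : Fin (n + 1) → K) (hp : p ≠ 0) (hq : q ≠ 0) (hpq : p * q ≠ 0),
    Projectivization.mk K p hp ∈ X ∧ Projectivization.mk K q hq ∈ Y ∧
      R = Projectivization.mk K (p * q) hpq}

variable {V W : Submodule K (Fin (n + 1) → K)} {X Y : Set (ProjSpace K n)}

theorem mk_mem_of_smul_eq {X : Set (ProjSpace K n)} {v w : Fin (n + 1) → K} (hv : v ≠ 0)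
    (hw : w ≠ 0) {c : K} (h : c • w = v) (hX : Projectivization.mk K w hw ∈ X) :
    Projectivization.mk K v hv ∈ X := by
  rwa [(Projectivization.mk_eq_mk_iff' K v w hv hw).mpr ⟨c, h⟩]

theorem mk_mem_productPoints_iff {r : Fin (n + 1) → K} (hr : r ≠ 0) :
    Projectivization.mk K r hr ∈ productPoints X Y ↔
      ∃ (p q : Fin (n + 1) → K) (hp : p ≠ 0) (hq : q ≠ 0), Projectivization.mk K p hp ∈ X ∧
        Projectivization.mk K q hq ∈ Y ∧ r = p * q := by
  constructor
  · rintro ⟨p, q, hp, hq, hpq, hpX, hqY, h⟩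
    obtain ⟨c, hc⟩ := (Projectivization.mk_eq_mk_iff' K _ _ hr hpq).mp h
    have hc0 : c ≠ 0 := by rintro rfl; exact hr (by simpa using hc.symm)
    exact ⟨c • p, q, smul_ne_zero hc0 hp, hq, mk_mem_of_smul_eq _ hp rfl hpX, hqY,
      by rw [smul_mul_assoc, hc]⟩
  · rintro ⟨p, q, hp, hq, hpX, hqY, rfl⟩
    exact ⟨p, q, hp, hq, hr, hpX, hqY, rfl⟩

theorem productPoints_subset (hX : X ⊆ linearPoints V) (hY : Y ⊆ linearPoints W) :
    productPoints X Y ⊆ linearPoints (V * W) := by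
  rintro _ ⟨p, q, hp, hq, hpq, hpX, hqY, rfl⟩
  rw [mk_mem_linearPoints]
  exact Submodule.mul_mem_mul ((mk_mem_linearPoints hp).mp (hX hpX))
    ((mk_mem_linearPoints hq).mp (hY hqY))

theorem productPoints_comm (X Y : Set (ProjSpace K n)) : productPoints X Y = productPoints Y X := by
  have : ∀ X Y : Set (ProjSpace K n), productPoints X Y ⊆ productPoints Y X := by
    rintro X Y _ ⟨p, q, hp, hq, hpq, hpX, hqY, rfl⟩
    exact ⟨q, p, hq, hp, by rwa [mul_comm], hqY, hpX, by simp only [mul_comm]⟩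
  exact (this X Y).antisymm (this Y X)

theorem compLinear_mem_vanishingForms (hX : X ⊆ linearPoints V) (hY : Y ⊆ linearPoints W)
    {T : (Fin (n + 1) → K) →ₗ[K] (Fin (n + 1) → K)} {g : (Fin (n + 1) → K) →ₗ[K] K}
    (hT : ∀ p ∈ V, ∀ q ∈ W, T (p * q) = g q • p)
    {F : MvPolynomial (Fin (n + 1)) K} (hF : F ∈ vanishingForms X) :
    compLinear T F ∈ vanishingForms (productPoints X Y) := by
  obtain ⟨⟨d, hd⟩, hFX⟩ := mem_vanishingForms_iff.mp hF
  refine mem_vanishingForms_iff.mpr ⟨⟨d, compLinear_isHomogeneous T hd⟩, fun r hr hrZ => ?_⟩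
  obtain ⟨p, q, hp, hq, hpX, hqY, rfl⟩ := (mk_mem_productPoints_iff hr).mp hrZ
  rw [eval_compLinear, hT p ((mk_mem_linearPoints hp).mp (hX hpX)) q
    ((mk_mem_linearPoints hq).mp (hY hqY)), eval_smul_of_isHomogeneous hd, hFX p hp hpX, mul_zero]

/-- The quadratic form expressing that the `k`-th coordinates of `f (T r) • r` and of `T r * T' r`
agree. -/
def factorForm (T T' : (Fin (n + 1) → K) →ₗ[K] (Fin (n + 1) → K)) (f : (Fin (n + 1) → K) →ₗ[K] K)
    (k : Fin (n + 1)) : MvPolynomial (Fin (n + 1)) K :=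
  linForm (f ∘ₗ T) * MvPolynomial.X k -
    linForm (LinearMap.proj k ∘ₗ T) * linForm (LinearMap.proj k ∘ₗ T')

theorem eval_factorForm (T T' : (Fin (n + 1) → K) →ₗ[K] (Fin (n + 1) → K))
    (f : (Fin (n + 1) → K) →ₗ[K] K) (k : Fin (n + 1)) (r : Fin (n + 1) → K) :
    eval r (factorForm T T' f k) = f (T r) * r k - T r k * T' r k := by
  simp [factorForm, eval_linForm]

theorem differential_factorForm (T T' : (Fin (n + 1) → K) →ₗ[K] (Fin (n + 1) → K))
    (f : (Fin (n + 1) → K) →ₗ[K] K) (k : Fin (n + 1)) (r w : Fin (n + 1) → K) :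
    differential (factorForm T T' f k) r w =
      f (T r) * w k + r k * f (T w) - (T r k * T' w k + T' r k * T w k) := by
  simp [factorForm, eval_linForm, differential_sub, differential_mul, differential_linForm,
    differential_X]

/-- At `r = p * q` both terms equal `f p * g q * p k * q k`. These quadrics force a vector to be a
product of its two recovered factors. -/
theorem factorForm_mem_vanishingForms (hX : X ⊆ linearPoints V) (hY : Y ⊆ linearPoints W)
    {T T' : (Fin (n + 1) → K) →ₗ[K] (Fin (n + 1) → K)} {f g : (Fin (n + 1) → K) →ₗ[K] K}
    (hT : ∀ p ∈ V, ∀ q ∈ W, T (p * q) = g q • p) (hT' : ∀ p ∈ V, ∀ q ∈ W, T' (p * q) = f p • q)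
    (k : Fin (n + 1)) : factorForm T T' f k ∈ vanishingForms (productPoints X Y) := by
  refine mem_vanishingForms_iff.mpr ⟨⟨2, ?_⟩, fun r hr hrZ => ?_⟩
  · exact ((linForm_isHomogeneous _).mul (isHomogeneous_X K k)).sub
      ((linForm_isHomogeneous _).mul (linForm_isHomogeneous _))
  · obtain ⟨p, q, hp, hq, hpX, hqY, rfl⟩ := (mk_mem_productPoints_iff hr).mp hrZ
    have hpV := (mk_mem_linearPoints hp).mp (hX hpX)
    have hqW := (mk_mem_linearPoints hq).mp (hY hqY)
    rw [eval_factorForm, hT p hpV q hqW, hT' p hpV q hqW]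
    simp
    ring

theorem isClosed_of_forall_vanishingForms {Z : Set (ProjSpace K n)}
    (h : ∀ (r : Fin (n + 1) → K) (hr : r ≠ 0), (∀ F ∈ vanishingForms Z, eval r F = 0) →
      Projectivization.mk K r hr ∈ Z) : IsClosed Z := by
  have : Z = projZeros (vanishingForms Z) := by
    refine Set.Subset.antisymm (fun P hP F hF => hF.2 P hP) fun P hP => ?_
    rw [← P.mk_rep]
    exact h _ P.rep_nonzero hP
  rw [this]
  exact isClosed_projZeros fun F hF => hF.1

theorem exists_rightFactor (hVW : V.LinearDisjoint W) :
    ∃ T : ((Fin (n + 1) → K) →ₗ[K] K) → (Fin (n + 1) → K) →ₗ[K] (Fin (n + 1) → K),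
      (∀ f r, T f r ∈ W) ∧ ∀ f, ∀ p ∈ V, ∀ q ∈ W, T f (p * q) = f p • q := by
  obtain ⟨T, hTW, hT, -⟩ := exists_leftFactor hVW.symm
  exact ⟨T, hTW, fun f p hp q hq => by rw [mul_comm, hT f q hq p hp]⟩

/-- Three families of equations suffice: the linear forms vanishing on `V * W`, the quadrics
`factorForm`, and the equations of `X` and `Y` pulled back along the factor maps. -/
theorem isClosed_productPoints (hVW : V.LinearDisjoint W) (hX : X ⊆ linearPoints V)
    (hY : Y ⊆ linearPoints W) (hXc : IsClosed X) (hYc : IsClosed Y) :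
    IsClosed (productPoints X Y) := by
  obtain ⟨T, hTV, hT, hT0⟩ := exists_leftFactor hVW
  obtain ⟨T', hTW', hT'⟩ := exists_rightFactor hVW
  refine isClosed_of_forall_vanishingForms fun r hr h => ?_
  have hrVW : r ∈ V * W := by
    rw [← Subspace.forall_mem_dualAnnihilator_apply_eq_zero_iff]
    intro φ hφ
    rw [← eval_linForm]
    exact h _ (linForm_mem_vanishingForms (productPoints_subset hX hY) hφ)
  obtain ⟨g, hg⟩ := hT0 r hrVW hr
  obtain ⟨i, hi⟩ := Function.ne_iff.mp hg
  let f : (Fin (n + 1) → K) →ₗ[K] K := LinearMap.proj i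
  have hfr : f (T g r) ≠ 0 := hi
  have hmul : f (T g r) • r = T g r * T' f r := by
    ext k
    have := h _ (factorForm_mem_vanishingForms hX hY (hT g) (hT' f) k)
    rw [eval_factorForm] at this
    exact sub_eq_zero.mp this
  have hq : T' f r ≠ 0 := by
    intro h0
    rw [h0, mul_zero] at hmul
    exact smul_ne_zero hfr hr hmul
  have hpX : Projectivization.mk K (T g r) hg ∈ X := by
    refine (mk_mem_iff_of_isClosed hXc hg).mpr fun F hF => ?_
    rw [← eval_compLinear]
    exact h _ (compLinear_mem_vanishingForms hX hY (hT g) hF)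
  have hqY : Projectivization.mk K (T' f r) hq ∈ Y := by
    refine (mk_mem_iff_of_isClosed hYc hq).mpr fun F hF => ?_
    rw [← eval_compLinear]
    refine h _ (productPoints_comm Y X ▸ compLinear_mem_vanishingForms hY hX (g := f) ?_ hF)
    intro q hq p hp
    rw [mul_comm, hT' f p hp q hq]
  refine ⟨T g r, T' f r, hg, hq, hmul ▸ smul_ne_zero hfr hr, hpX, hqY, ?_⟩
  refine (Projectivization.mk_eq_mk_iff' K _ _ _ _).mpr ⟨(f (T g r))⁻¹, ?_⟩
  rw [← hmul, inv_smul_smul₀ hfr]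

theorem hadamard_eq_productPoints (hVW : V.LinearDisjoint W) (hX : X ⊆ linearPoints V)
    (hY : Y ⊆ linearPoints W) (hXc : IsClosed X) (hYc : IsClosed Y) :
    hadamard X Y = productPoints X Y :=
  -- `productPoints` is by definition the set inside the closure in `hadamard`.
  (isClosed_productPoints hVW hX hY hXc hYc).closure_eq

/-- Multiplication by a fixed vector pulls closed sets back to closed sets, on a set where the
products are nonzero. -/
theorem exists_isClosed_mul_mem {C : Set (ProjSpace K n)} (hC : IsClosed C) (p : Fin (n + 1) → K) :
    ∃ D : Set (ProjSpace K n), IsClosed D ∧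
      ∀ (q : Fin (n + 1) → K) (hq : q ≠ 0) (hpq : p * q ≠ 0),
        Projectivization.mk K q hq ∈ D ↔ Projectivization.mk K (p * q) hpq ∈ C := by
  have hS : ∀ G ∈ compLinear (LinearMap.mulLeft K p) '' vanishingForms C, ∃ d,
      G.IsHomogeneous d := by
    rintro _ ⟨F, ⟨⟨d, hd⟩, -⟩, rfl⟩
    exact ⟨d, compLinear_isHomogeneous _ hd⟩
  refine ⟨_, isClosed_projZeros hS, fun q hq hpq => ?_⟩
  rw [mk_mem_projZeros_iff hS, mk_mem_iff_of_isClosed hC]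
  simp [eval_compLinear]

theorem isIrreducible_productPoints (hVW : V.LinearDisjoint W) (hX : X ⊆ linearPoints V)
    (hY : Y ⊆ linearPoints W) (hXi : IsIrreducible X) (hYi : IsIrreducible Y) :
    IsIrreducible (productPoints X Y) := by
  have hne : ∀ {p q : Fin (n + 1) → K} (hp : p ≠ 0) (hq : q ≠ 0), Projectivization.mk K p hp ∈ X →
      Projectivization.mk K q hq ∈ Y → p * q ≠ 0 := fun hp hq hpX hqY =>
    mul_ne_zero_of_linearDisjoint hVW ((mk_mem_linearPoints hp).mp (hX hpX))
      ((mk_mem_linearPoints hq).mp (hY hqY)) hp hq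
  refine ⟨?_, isPreirreducible_iff_isClosed_union_isClosed.mpr fun C₁ C₂ hC₁ hC₂ hZ => ?_⟩
  · obtain ⟨P, hP⟩ := hXi.1
    obtain ⟨Q, hQ⟩ := hYi.1
    rw [← P.mk_rep] at hP
    rw [← Q.mk_rep] at hQ
    exact ⟨_, P.rep, Q.rep, P.rep_nonzero, Q.rep_nonzero, hne _ _ hP hQ, hP, hQ, rfl⟩
  -- The points `P` whose whole slice `P * Y` lies in `C`. Irreducibility of `Y` puts each slice
  -- inside `C₁` or `C₂`; irreducibility of `X` then makes the choice uniform.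
  · let slice (C : Set (ProjSpace K n)) : Set (ProjSpace K n) :=
      {P | ∀ (q : Fin (n + 1) → K) (hq : q ≠ 0), Projectivization.mk K q hq ∈ Y →
        ∀ F ∈ vanishingForms C, eval (q * P.rep) F = 0}
    have hslice : ∀ C, IsClosed (slice C) := by
      intro C
      have hS : ∀ G ∈ {G | ∃ (q : Fin (n + 1) → K) (hq : q ≠ 0), Projectivization.mk K q hq ∈ Y ∧
          ∃ F ∈ vanishingForms C, compLinear (LinearMap.mulLeft K q) F = G}, ∃ d,
          G.IsHomogeneous d := by
        rintro _ ⟨q, hq, -, F, ⟨⟨d, hd⟩, -⟩, rfl⟩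
        exact ⟨d, compLinear_isHomogeneous _ hd⟩
      convert isClosed_projZeros hS
      ext P
      constructor
      · rintro h _ ⟨q, hq, hqY, F, hF, rfl⟩
        rw [eval_compLinear]
        exact h q hq hqY F hF
      · intro h q hq hqY F hF
        have := h _ ⟨q, hq, hqY, F, hF, rfl⟩
        rwa [eval_compLinear] at this
    have hcover : X ⊆ slice C₁ ∪ slice C₂ := by
      intro P hP
      have hP' : Projectivization.mk K P.rep P.rep_nonzero ∈ X := by rwa [P.mk_rep]
      obtain ⟨D₁, hD₁, h₁⟩ := exists_isClosed_mul_mem hC₁ P.rep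
      obtain ⟨D₂, hD₂, h₂⟩ := exists_isClosed_mul_mem hC₂ P.rep
      have hmem : ∀ {C D : Set (ProjSpace K n)}, IsClosed C →
          (∀ (q : Fin (n + 1) → K) (hq : q ≠ 0) (hpq : P.rep * q ≠ 0),
            Projectivization.mk K q hq ∈ D ↔ Projectivization.mk K (P.rep * q) hpq ∈ C) →
          Y ⊆ D → P ∈ slice C := by
        intro C D hC hD hYD q hq hqY F hF
        have hpq := hne _ hq hP' hqY
        rw [mul_comm]
        exact (mk_mem_iff_of_isClosed hC hpq).mp ((hD q hq hpq).mp (hYD hqY)) F hF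
      rcases isPreirreducible_iff_isClosed_union_isClosed.mp hYi.2 D₁ D₂ hD₁ hD₂ (by
        intro Q hQ
        rw [← Q.mk_rep] at hQ ⊢
        have hpq := hne _ Q.rep_nonzero hP' hQ
        refine (hZ ⟨_, _, _, _, hpq, hP', hQ, rfl⟩).imp ?_ ?_
        · exact (h₁ _ _ hpq).mpr
        · exact (h₂ _ _ hpq).mpr) with h | h
      · exact .inl (hmem hC₁ h₁ h)
      · exact .inr (hmem hC₂ h₂ h)
    have hfinal : ∀ {C : Set (ProjSpace K n)}, IsClosed C → X ⊆ slice C →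
        productPoints X Y ⊆ C := by
      rintro C hC hXC _ ⟨p, q, hp, hq, hpq, hpX, hqY, rfl⟩
      refine (mk_mem_iff_of_isClosed hC hpq).mpr fun F hF => ?_
      obtain ⟨a, ha⟩ := Projectivization.exists_smul_eq_mk_rep K p hp
      have := hXC hpX q hq hqY F hF
      obtain ⟨d, hd⟩ := hF.1
      rw [← ha, Units.smul_def, mul_smul_comm, eval_smul_of_isHomogeneous hd, mul_comm q] at this
      simpa using this
    exact (isPreirreducible_iff_isClosed_union_isClosed.mp hXi.2 _ _ (hslice C₁) (hslice C₂)
      hcover).imp (hfinal hC₁) (hfinal hC₂)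

end TwoFactors

/-! ### Smoothness of Hadamard products of two varieties -/

section TwoFactorsSmooth

variable {K : Type*} [Field K] {n : ℕ}
  {V W : Submodule K (Fin (n + 1) → K)} {X Y : Set (ProjSpace K n)}

theorem mul_mem_tangentSpace_productPoints (hVW : V.LinearDisjoint W) (hX : X ⊆ linearPoints V)
    (hY : Y ⊆ linearPoints W) {p q : Fin (n + 1) → K} (hp : p ≠ 0) (hq : q ≠ 0)
    (hpX : Projectivization.mk K p hp ∈ X) (hqY : Projectivization.mk K q hq ∈ Y)
    {u : Fin (n + 1) → K} (hu : u ∈ tangentSpace X p) :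
    u * q ∈ tangentSpace (productPoints X Y) (p * q) := by
  have hqW := (mk_mem_linearPoints hq).mp (hY hqY)
  have hne : ∀ {x : Fin (n + 1) → K} (hx : x ≠ 0), Projectivization.mk K x hx ∈ X → x * q ≠ 0 :=
    fun hx hxX => mul_ne_zero_of_linearDisjoint hVW ((mk_mem_linearPoints hx).mp (hX hxX)) hqW hx hq
  have hZ : Projectivization.mk K (p * q) (hne hp hpX) ∈ productPoints X Y :=
    ⟨p, q, hp, hq, hne hp hpX, hpX, hqY, rfl⟩
  refine (mem_tangentSpace_iff (hne hp hpX) hZ).mpr fun F hF => ?_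
  obtain ⟨⟨d, hd⟩, hFZ⟩ := mem_vanishingForms_iff.mp hF
  rw [mem_tangentSpace_iff hp hpX] at hu
  have := hu (compLinear (LinearMap.mulRight K q) F) (mem_vanishingForms_iff.mpr
    ⟨⟨d, compLinear_isHomogeneous _ hd⟩, fun x hx hxX => by
      rw [eval_compLinear]
      exact hFZ _ (hne hx hxX) ⟨x, q, hx, hq, hne hx hxX, hxX, hqY, rfl⟩⟩)
  rwa [differential_compLinear] at this

theorem mem_tangentSpace_of_compLinear (hX : X ⊆ linearPoints V) (hY : Y ⊆ linearPoints W)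
    {p q : Fin (n + 1) → K} (hp : p ≠ 0) (hq : q ≠ 0)
    (hpX : Projectivization.mk K p hp ∈ X) (hqY : Projectivization.mk K q hq ∈ Y)
    {T : (Fin (n + 1) → K) →ₗ[K] (Fin (n + 1) → K)} {g : (Fin (n + 1) → K) →ₗ[K] K}
    (hT : ∀ p ∈ V, ∀ q ∈ W, T (p * q) = g q • p) (hg : g q ≠ 0) {w : Fin (n + 1) → K}
    (hw : w ∈ tangentSpace (productPoints X Y) (p * q)) : T w ∈ tangentSpace X p := by
  rw [mem_tangentSpace_iff hp hpX]
  intro F hF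
  obtain ⟨d, hd⟩ := hF.1
  have := hw _ (Ideal.subset_span (compLinear_mem_vanishingForms hX hY hT hF))
  change differential _ _ _ = 0 at this
  rwa [differential_compLinear, hT p ((mk_mem_linearPoints hp).mp (hX hpX)) q
    ((mk_mem_linearPoints hq).mp (hY hqY)), differential_smul_eq_zero_iff hd hg] at this

/-- One inclusion is the chain rule for multiplication by a fixed factor. For the other, the factor
maps send a tangent vector `w` into the tangent spaces of `X` and `Y`, and the differentials of the
quadrics rebuild `w` from these images. -/
theorem tangentSpace_productPoints (hVW : V.LinearDisjoint W) (hX : X ⊆ linearPoints V)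
    (hY : Y ⊆ linearPoints W) {p q : Fin (n + 1) → K} (hp : p ≠ 0) (hq : q ≠ 0)
    (hpX : Projectivization.mk K p hp ∈ X) (hqY : Projectivization.mk K q hq ∈ Y) :
    tangentSpace (productPoints X Y) (p * q) =
      (tangentSpace X p).map (LinearMap.mulRight K q) ⊔
        (tangentSpace Y q).map (LinearMap.mulLeft K p) := by
  apply le_antisymm
  · intro w hw
    obtain ⟨T, hTV, hT, hT0⟩ := exists_leftFactor hVW
    obtain ⟨T', hTW', hT'⟩ := exists_rightFactor hVW
    obtain ⟨i, hi⟩ := Function.ne_iff.mp hp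
    obtain ⟨j, hj⟩ := Function.ne_iff.mp hq
    let f : (Fin (n + 1) → K) →ₗ[K] K := LinearMap.proj i
    let g : (Fin (n + 1) → K) →ₗ[K] K := LinearMap.proj j
    have hf : f p ≠ 0 := hi
    have hg : g q ≠ 0 := hj
    have hpV := (mk_mem_linearPoints hp).mp (hX hpX)
    have hqW := (mk_mem_linearPoints hq).mp (hY hqY)
    have hu : T g w ∈ tangentSpace X p :=
      mem_tangentSpace_of_compLinear hX hY hp hq hpX hqY (hT g) hg hw
    have hu' : T' f w ∈ tangentSpace Y q := by
      refine mem_tangentSpace_of_compLinear hY hX hq hp hqY hpX (g := f) ?_ hf ?_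
      · intro y hy x hx
        rw [mul_comm, hT' f x hx y hy]
      · rwa [productPoints_comm, mul_comm]
    -- This is the vanishing of the differential of `factorForm` at `p * q`. The correction by a
    -- multiple of `p` is allowed because `p` is itself tangent, by Euler's formula.
    have key : (f p * g q) • w =
        (f p • T g w - f (T g w) • p) * q + p * (g q • T' f w) := by
      ext k
      have := hw _ (Ideal.subset_span (factorForm_mem_vanishingForms hX hY (hT g) (hT' f) k))
      change differential _ _ _ = 0 at this
      rw [differential_factorForm, hT g p hpV q hqW, hT' f p hpV q hqW] at this
      simp only [map_smul, Pi.smul_apply, smul_eq_mul, Pi.mul_apply, Pi.add_apply,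
        Pi.sub_apply] at this ⊢
      linear_combination this
    have hmem : (f p * g q) • w ∈ (tangentSpace X p).map (LinearMap.mulRight K q) ⊔
        (tangentSpace Y q).map (LinearMap.mulLeft K p) := by
      rw [key]
      refine Submodule.add_mem_sup ⟨_, ?_, rfl⟩ ⟨_, Submodule.smul_mem _ _ hu', rfl⟩
      exact Submodule.sub_mem _ (Submodule.smul_mem _ _ hu)
        (Submodule.smul_mem _ _ (self_mem_tangentSpace hp hpX))
    exact (Submodule.smul_mem_iff _ (mul_ne_zero hf hg)).mp hmem
  · refine sup_le ?_ ?_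
    · rintro _ ⟨u, hu, rfl⟩
      exact mul_mem_tangentSpace_productPoints hVW hX hY hp hq hpX hqY hu
    · rintro _ ⟨u, hu, rfl⟩
      rw [productPoints_comm, LinearMap.mulLeft_apply, mul_comm, mul_comm p]
      exact mul_mem_tangentSpace_productPoints hVW.symm hY hX hq hp hqY hpX hu

theorem finrank_map_of_injOn {E E' : Type*} [AddCommGroup E] [Module K E] [AddCommGroup E']
    [Module K E'] (f : E →ₗ[K] E') (S : Submodule K E) (h : ∀ x ∈ S, f x = 0 → x = 0) :
    Module.finrank K (S.map f) = Module.finrank K S := by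
  rw [← LinearMap.range_domRestrict]
  refine LinearMap.finrank_range_of_inj ((injective_iff_map_eq_zero _).mpr fun x hx => ?_)
  exact Subtype.ext (h x x.2 hx)

theorem finrank_tangentSpace_productPoints (hVW : V.LinearDisjoint W) (hX : X ⊆ linearPoints V)
    (hY : Y ⊆ linearPoints W) {p q : Fin (n + 1) → K} (hp : p ≠ 0) (hq : q ≠ 0)
    (hpX : Projectivization.mk K p hp ∈ X) (hqY : Projectivization.mk K q hq ∈ Y) :
    Module.finrank K (tangentSpace (productPoints X Y) (p * q)) + 1 =
      Module.finrank K (tangentSpace X p) + Module.finrank K (tangentSpace Y q) := by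
  have hpV := (mk_mem_linearPoints hp).mp (hX hpX)
  have hqW := (mk_mem_linearPoints hq).mp (hY hqY)
  have hinf : (tangentSpace X p).map (LinearMap.mulRight K q) ⊓
        (tangentSpace Y q).map (LinearMap.mulLeft K p) = K ∙ (p * q) := by
    apply le_antisymm
    · rintro _ ⟨⟨u, hu, rfl⟩, ⟨u', hu', h⟩⟩
      simp only [LinearMap.mulLeft_apply, LinearMap.mulRight_apply] at h ⊢
      obtain ⟨T, -, hT, -⟩ := exists_leftFactor hVW
      obtain ⟨j, hj⟩ := Function.ne_iff.mp hq
      -- Applying the left factor map to `p * u' = u * q` shows that `u` is a multiple of `p`.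
      have h' := congrArg (T (LinearMap.proj j)) h
      rw [hT _ p hpV u' (tangentSpace_le hY q hu'), hT _ u (tangentSpace_le hX p hu) q hqW] at h'
      have hu : u = ((q j)⁻¹ * u' j) • p := by
        rw [mul_smul, eq_inv_smul_iff₀ hj]
        exact h'.symm
      rw [hu, smul_mul_assoc]
      exact Submodule.smul_mem _ _ (Submodule.mem_span_singleton_self _)
    · rw [Submodule.span_singleton_le_iff_mem]
      exact ⟨⟨p, self_mem_tangentSpace hp hpX, rfl⟩, ⟨q, self_mem_tangentSpace hq hqY, rfl⟩⟩
  have h := Submodule.finrank_sup_add_finrank_inf_eq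
    ((tangentSpace X p).map (LinearMap.mulRight K q))
    ((tangentSpace Y q).map (LinearMap.mulLeft K p))
  rw [hinf, finrank_span_singleton (mul_ne_zero_of_linearDisjoint hVW hpV hqW hp hq),
    ← tangentSpace_productPoints hVW hX hY hp hq hpX hqY, finrank_map_of_injOn,
    finrank_map_of_injOn] at h
  · exact h
  · intro u hu h0
    by_contra hu0
    exact mul_ne_zero_of_linearDisjoint hVW hpV (tangentSpace_le hY q hu) hp hu0 h0
  · intro u hu h0
    by_contra hu0
    exact mul_ne_zero_of_linearDisjoint hVW (tangentSpace_le hX p hu) hqW hu0 hq h0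

/-- The tangent dimension is the same at all points of the product, and at one of them it is the
Krull dimension. -/
theorem isSmooth_productPoints [CharZero K] (hVW : V.LinearDisjoint W) (hX : X ⊆ linearPoints V)
    (hY : Y ⊆ linearPoints W) (hXi : IsIrreducible X) (hYi : IsIrreducible Y) (hXs : IsSmooth X)
    (hYs : IsSmooth Y) : IsSmooth (productPoints X Y) := by
  obtain ⟨v, hv, hvZ, hdim⟩ := exists_finrank_tangentSpace_eq_ringKrullDim
    (isIrreducible_productPoints hVW hX hY hXi hYi)
  intro r hr hrZ
  rw [← hdim]
  obtain ⟨p, q, hp, hq, hpX, hqY, rfl⟩ := (mk_mem_productPoints_iff hv).mp hvZ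
  obtain ⟨p', q', hp', hq', hpX', hqY', rfl⟩ := (mk_mem_productPoints_iff hr).mp hrZ
  have h := finrank_tangentSpace_productPoints hVW hX hY hp hq hpX hqY
  have h' := finrank_tangentSpace_productPoints hVW hX hY hp' hq' hpX' hqY'
  have h₁ : Module.finrank K (tangentSpace X p) = Module.finrank K (tangentSpace X p') := by
    exact_mod_cast (hXs p hp hpX).trans (hXs p' hp' hpX').symm
  have h₂ : Module.finrank K (tangentSpace Y q) = Module.finrank K (tangentSpace Y q') := by
    exact_mod_cast (hYs q hq hqY).trans (hYs q' hq' hqY').symm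
  congr 1
  omega

end TwoFactorsSmooth

/-! ### Iterated Hadamard products -/

section Iterated

variable {K : Type*} [Field K] {n : ℕ}

theorem injective_of_finrank_range_eq {E E' : Type*} [AddCommGroup E] [Module K E]
    [FiniteDimensional K E] [AddCommGroup E'] [Module K E'] {f : E →ₗ[K] E'}
    (h : Module.finrank K (LinearMap.range f) = Module.finrank K E) : Function.Injective f := by
  have := f.finrank_range_add_finrank_ker
  exact LinearMap.ker_eq_bot.mp (Submodule.finrank_eq_zero.mp (by omega))

open TensorProduct in
theorem finrank_mul_le (V W : Submodule K (Fin (n + 1) → K)) :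
    Module.finrank K ↥(V * W) ≤ Module.finrank K V * Module.finrank K W := by
  rw [← Submodule.mulMap_range, ← Module.finrank_tensorProduct]
  exact LinearMap.finrank_range_le (M := V ⊗[K] W) (V.mulMap W)

open TensorProduct in
theorem linearDisjoint_of_finrank_mul_eq {V W : Submodule K (Fin (n + 1) → K)}
    (h : Module.finrank K ↥(V * W) = Module.finrank K V * Module.finrank K W) :
    V.LinearDisjoint W := by
  rw [← Submodule.mulMap_range, ← Module.finrank_tensorProduct] at h
  exact ⟨injective_of_finrank_range_eq (E := V ⊗[K] W) h⟩

theorem finrank_prod_le {m : ℕ} (V : Fin m → Submodule K (Fin (n + 1) → K)) :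
    Module.finrank K ↥(∏ i, V i) ≤ ∏ i, Module.finrank K (V i) := by
  induction m with
  | zero =>
    rw [Fin.prod_univ_zero, Fin.prod_univ_zero, Submodule.one_eq_span]
    exact (finrank_span_singleton one_ne_zero).le
  | succ m ih =>
    rw [Fin.prod_univ_castSucc, Fin.prod_univ_castSucc]
    exact (finrank_mul_le _ _).trans (Nat.mul_le_mul_right _ (ih _))

/-- The containment in `∏ V i` lets the induction apply the two-factor results; the description of
points as plain products is what the comparison with the Segre embedding uses. -/
theorem hadamardProd_properties [CharZero K] (ℓ : ℕ)
    (V : Fin (ℓ + 1) → Submodule K (Fin (n + 1) → K)) (hV0 : ∀ i, 0 < Module.finrank K (V i))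
    (hV : Module.finrank K ↥(∏ i, V i) = ∏ i, Module.finrank K (V i))
    (X : Fin (ℓ + 1) → Set (ProjSpace K n)) (hX : ∀ i, IsVariety (X i))
    (hXV : ∀ i, X i ⊆ linearPoints (V i)) :
    IsVariety (hadamardProd ℓ X) ∧ hadamardProd ℓ X ⊆ linearPoints (∏ i, V i) ∧
      (∀ (r : Fin (n + 1) → K) (hr : r ≠ 0), Projectivization.mk K r hr ∈ hadamardProd ℓ X ↔
        ∃ p : Fin (ℓ + 1) → Fin (n + 1) → K,
          (∀ i, ∃ hp : p i ≠ 0, Projectivization.mk K (p i) hp ∈ X i) ∧ r = ∏ i, p i) ∧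
      ((∀ i, IsSmooth (X i)) → IsSmooth (hadamardProd ℓ X)) := by
  induction ℓ with
  | zero =>
    refine ⟨hX 0, ?_, fun r hr => ⟨fun h => ⟨fun _ => r, ?_, by simp⟩, ?_⟩, fun h => h 0⟩
    · rw [Fin.prod_univ_one]
      exact hXV 0
    · intro i
      rw [Fin.fin_one_eq_zero i]
      exact ⟨hr, h⟩
    · rintro ⟨p, hp, rfl⟩
      obtain ⟨h0, h⟩ := hp 0
      simpa [hadamardProd] using h
  | succ ℓ ih =>
    rw [Fin.prod_univ_castSucc V, Fin.prod_univ_castSucc fun i => Module.finrank K (V i)] at hV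
    have hle := finrank_prod_le fun i : Fin (ℓ + 1) => V i.castSucc
    -- If the partial product fell short of full dimension, so would the whole product, because the
    -- last factor has positive dimension.
    have hV' : Module.finrank K ↥(∏ i : Fin (ℓ + 1), V i.castSucc) =
        ∏ i : Fin (ℓ + 1), Module.finrank K (V i.castSucc) := by
      refine hle.antisymm (Nat.le_of_mul_le_mul_right ?_ (hV0 (Fin.last _)))
      exact hV.symm.le.trans (finrank_mul_le _ _)
    rw [← hV'] at hV
    have hdisj := linearDisjoint_of_finrank_mul_eq hV
    obtain ⟨hvar, hsub, hmem, hsmooth⟩ := ih (fun i => V i.castSucc) (fun i => hV0 _) hV'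
      (fun i => X i.castSucc) (fun i => hX _) fun i => hXV _
    have heq : hadamardProd (ℓ + 1) X =
        productPoints (hadamardProd ℓ fun i => X i.castSucc) (X (Fin.last _)) :=
      hadamard_eq_productPoints hdisj hsub (hXV _) hvar.1 (hX _).1
    rw [heq]
    refine ⟨⟨isClosed_productPoints hdisj hsub (hXV _) hvar.1 (hX _).1,
      isIrreducible_productPoints hdisj hsub (hXV _) hvar.2 (hX _).2⟩, ?_, fun r hr => ?_, fun h =>
      isSmooth_productPoints hdisj hsub (hXV _) hvar.2 (hX _).2 (hsmooth fun i => h _) (h _)⟩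
    · rw [Fin.prod_univ_castSucc]
      exact productPoints_subset hsub (hXV _)
    · rw [mk_mem_productPoints_iff]
      constructor
      · rintro ⟨p, q, hp, hq, hpX, hqX, rfl⟩
        obtain ⟨p, hpX', rfl⟩ := (hmem p hp).mp hpX
        refine ⟨Fin.snoc (α := fun _ => Fin (n + 1) → K) p q, fun i => ?_, ?_⟩
        · induction i using Fin.lastCases with
          | last => simpa using ⟨hq, hqX⟩
          | cast i => simpa using hpX' i
        · simp [Fin.prod_univ_castSucc]
      · rintro ⟨p, hpX, rfl⟩
        rw [Fin.prod_univ_castSucc] at hr ⊢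
        obtain ⟨hq, hqX⟩ := hpX (Fin.last _)
        have hp := left_ne_zero_of_mul hr
        exact ⟨_, _, hp, hq, (hmem _ hp).mpr ⟨_, fun i => hpX _, rfl⟩, hqX, rfl⟩

end Iterated

/-! ### The matrix of products of parametrizations -/

section ProductMatrix

variable {K : Type*} [Field K] {m n : ℕ} {h : Fin m → ℕ}

/-- The matrix whose columns are the coordinatewise products of columns of the matrices `A i`. -/
def productMatrix {R : Type*} [CommRing R] (A : ∀ i, Matrix (Fin (n + 1)) (Fin (h i + 1)) R) :
    Matrix (Fin (n + 1)) (∀ i, Fin (h i + 1)) R :=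
  fun k J => ∏ i, A i k (J i)

/-- Expanding a product of sums exhibits products of parametrized points as a linear image of the
Segre vector. -/
theorem productMatrix_mulVec (A : ∀ i, Matrix (Fin (n + 1)) (Fin (h i + 1)) K)
    (y : ∀ i, Fin (h i + 1) → K) :
    (productMatrix A).mulVec (fun J => ∏ i, y i (J i)) = ∏ i, (A i).mulVec (y i) := by
  ext k
  simp only [Matrix.mulVec, dotProduct, productMatrix, Finset.prod_apply, Finset.prod_univ_sum,
    Fintype.piFinset_univ, Finset.prod_mul_distrib]

theorem range_productMatrix (A : ∀ i, Matrix (Fin (n + 1)) (Fin (h i + 1)) K) :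
    LinearMap.range (productMatrix A).mulVecLin = ∏ i, LinearMap.range (A i).mulVecLin := by
  simp only [Matrix.range_mulVecLin, Submodule.prod_span]
  congr 1
  ext v
  rw [Set.mem_fintype_prod]
  constructor
  · rintro ⟨J, rfl⟩
    refine ⟨fun i => (A i).col (J i), fun i => ⟨J i, rfl⟩, ?_⟩
    ext k
    simp [productMatrix, Matrix.col]
  · rintro ⟨c, hc, rfl⟩
    choose J hJ using hc
    refine ⟨J, ?_⟩
    ext k
    simp [productMatrix, Matrix.col, ← hJ]

/-- Row rank equals column rank. The row selection `s` need not be assumed injective, since a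
repeated row makes the minor zero. -/
theorem finrank_range_mulVecLin_eq_card_iff {ι κ : Type*} [Fintype ι] [Fintype κ] [DecidableEq κ]
    (M : Matrix ι κ K) :
    Module.finrank K (LinearMap.range M.mulVecLin) = Fintype.card κ ↔
      ∃ s : κ → ι, (M.submatrix s id).det ≠ 0 := by
  constructor
  · intro hM
    obtain ⟨τ, a, ha, hspan, hli⟩ := exists_linearIndependent' K M.row
    have hfin : Module.finrank K (Submodule.span K (Set.range M.row)) = Fintype.card κ := by
      rw [← Matrix.rank_eq_finrank_span_row]
      exact hM
    have : Finite τ := Finite.of_injective a ha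
    have := Fintype.ofFinite τ
    have hcard : Fintype.card τ = Fintype.card κ := by
      rw [← finrank_span_eq_card hli, hspan, hfin]
    let e : κ ≃ τ := (Fintype.equivOfCardEq hcard).symm
    refine ⟨a ∘ e, IsUnit.ne_zero ((Matrix.isUnit_iff_isUnit_det _).mp ?_)⟩
    rw [← Matrix.linearIndependent_rows_iff_isUnit]
    exact hli.comp e e.injective
  · rintro ⟨s, hs⟩
    rw [LinearMap.finrank_range_of_inj, Module.finrank_fintype_fun_eq_card]
    refine (injective_iff_map_eq_zero _).mpr fun x hx => ?_
    refine Matrix.eq_zero_of_mulVec_eq_zero hs ?_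
    ext i
    exact congrFun hx (s i)

theorem exists_linearEquiv_comp_eq {E E' : Type*} [AddCommGroup E] [Module K E] [AddCommGroup E']
    [Module K E'] [FiniteDimensional K E'] {M N : E →ₗ[K] E'} (hM : Function.Injective M)
    (hN : Function.Injective N) : ∃ g : E' ≃ₗ[K] E', ∀ x, g (M x) = N x := by
  obtain ⟨g, hg⟩ := Submodule.exists_linearEquiv_restrict_eq
    ((LinearEquiv.ofInjective M hM).symm ≪≫ₗ LinearEquiv.ofInjective N hN)
  refine ⟨g, fun x => ?_⟩
  have := hg (LinearEquiv.ofInjective M hM x)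
  rw [LinearEquiv.trans_apply, LinearEquiv.symm_apply_apply] at this
  exact this.symm

/-- The inclusion of the coordinate subspace given by `e`, as a linear map. -/
def extendLinear (e : (∀ i, Fin (h i + 1)) ↪ Fin (n + 1)) :
    ((∀ i, Fin (h i + 1)) → K) →ₗ[K] (Fin (n + 1) → K) where
  toFun x := Function.extend e x 0
  map_add' x y := by
    simpa using Function.extend_add e x y 0 0
  map_smul' c x := by
    simpa using Function.extend_smul c e x 0

theorem extendLinear_injective (e : (∀ i, Fin (h i + 1)) ↪ Fin (n + 1)) :
    Function.Injective (extendLinear (K := K) e) := by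
  intro x y hxy
  ext J
  simpa [extendLinear, e.injective.extend_apply] using congrFun hxy (e J)

theorem extendLinear_prod (e : (∀ i, Fin (h i + 1)) ↪ Fin (n + 1)) (y : ∀ i, Fin (h i + 1) → K) :
    extendLinear e (fun J => ∏ i, y i (J i)) = segreVec e y :=
  rfl

theorem segreVec_smul (e : (∀ i, Fin (h i + 1)) ↪ Fin (n + 1)) (c : Fin m → K)
    (y : ∀ i, Fin (h i + 1) → K) :
    segreVec e (fun i => c i • y i) = (∏ i, c i) • segreVec e y := by
  rw [← extendLinear_prod, ← extendLinear_prod, ← map_smul]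
  congr 1
  ext J
  simp [Finset.prod_mul_distrib]

end ProductMatrix

/-! ### Genericity -/

section Generic

variable {K : Type*} [Field K] {m n : ℕ} {h : Fin m → ℕ}

/-- The tuples of linear subspaces whose product is of the largest possible dimension. -/
def genericTuples (K : Type*) [Field K] (n : ℕ) {m : ℕ} (h : Fin m → ℕ) :
    Set (∀ i, Grass K n (h i)) :=
  {L | Module.finrank K ↥(∏ i, (L i).1) = ∏ i, (h i + 1)}

theorem mem_genericTuples_iff {L : ∀ i, Grass K n (h i)}
    {V : Fin m → Submodule K (Fin (n + 1) → K)} (hV : ∀ i, (L i).1 = V i) :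
    L ∈ genericTuples K n h ↔ Module.finrank K ↥(∏ i, V i) = ∏ i, (h i + 1) := by
  obtain rfl : (fun i => (L i).1) = V := funext hV
  rfl

theorem card_multiIndex : Fintype.card (∀ i, Fin (h i + 1)) = ∏ i, (h i + 1) := by
  simp

theorem isOpenGrass_genericTuples : IsOpenGrass (genericTuples K n h) := by
  let D (s : (∀ i, Fin (h i + 1)) → Fin (n + 1)) :
      MvPolynomial (Σ i : Fin m, Fin (n + 1) × Fin (h i + 1)) K :=
    ((productMatrix fun i => Matrix.of fun k j => X ⟨i, (k, j)⟩).submatrix s id).det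
  refine ⟨Ideal.span (Set.range D), fun A L hL => ?_⟩
  have hD : ∀ s, aeval (flatten A) (D s) = ((productMatrix A).submatrix s id).det := by
    intro s
    rw [AlgHom.map_det]
    congr 1
    ext J J'
    simp [productMatrix, flatten]
  have hlocus : flatten A ∈ zeroLocus K (Ideal.span (Set.range D)) ↔
      ∀ s, ((productMatrix A).submatrix s id).det = 0 := by
    rw [zeroLocus_span]
    simp only [← hD, Set.mem_ofPred_eq, Set.forall_mem_range]
  rw [hlocus, mem_genericTuples_iff hL, ← card_multiIndex, ← range_productMatrix,
    finrank_range_mulVecLin_eq_card_iff, not_forall]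

theorem genericTuples_nonempty (hn : (∏ i, (h i + 1)) - 1 ≤ n) :
    (genericTuples K n h).Nonempty := by
  classical
  obtain ⟨e⟩ : Nonempty ((∀ i, Fin (h i + 1)) ↪ Fin (n + 1)) := by
    rw [Function.Embedding.nonempty_iff_card_le, card_multiIndex, Fintype.card_fin]
    omega
  -- Row `e J` of `A i` is the unit vector at `J i`, so the rows of `productMatrix A` selected by
  -- `e` form the identity matrix.
  let A (i : Fin m) : Matrix (Fin (n + 1)) (Fin (h i + 1)) K :=
    Matrix.of fun k j => if ∃ J, e J = k ∧ J i = j then 1 else 0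
  have hA : ∀ i J j, A i (e J) j = if J i = j then 1 else 0 := by
    intro i J j
    simp [A]
  have hinj : ∀ i, Function.Injective (A i).mulVecLin := by
    intro i
    refine (injective_iff_map_eq_zero _).mpr fun y hy => ?_
    ext j
    have := congrFun hy (e (Function.update 0 i j))
    simpa [Matrix.mulVec, dotProduct, hA] using this
  refine ⟨fun i => ⟨LinearMap.range (A i).mulVecLin, ?_⟩, ?_⟩
  · rw [LinearMap.finrank_range_of_inj (hinj i)]
    simp
  · change Module.finrank K ↥(∏ i, LinearMap.range (A i).mulVecLin) = _
    rw [← range_productMatrix, ← card_multiIndex, finrank_range_mulVecLin_eq_card_iff]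
    refine ⟨e, ?_⟩
    have : (productMatrix A).submatrix e id = 1 := by
      ext J J'
      simp only [Matrix.submatrix_apply, productMatrix, hA, id, Matrix.one_apply,
        Finset.prod_ite_zero]
      simp [funext_iff]
    simp [this]

theorem projectivelyEquivalent_productVariety {L : ∀ i, Grass K n (h i)}
    (hL : L ∈ genericTuples K n h) {X : Fin m → Set (ProjSpace K n)}
    (hXL : ∀ i, X i ⊆ linearPoints (L i).1) {H : Set (ProjSpace K n)}
    (hH : ∀ (r : Fin (n + 1) → K) (hr : r ≠ 0), Projectivization.mk K r hr ∈ H ↔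
      ∃ p : Fin m → Fin (n + 1) → K,
        (∀ i, ∃ hp : p i ≠ 0, Projectivization.mk K (p i) hp ∈ X i) ∧ r = ∏ i, p i)
    (φ : ∀ i, (Fin (h i + 1) → K) →ₗ[K] (Fin (n + 1) → K))
    (hφ : ∀ i, Function.Injective (φ i)) (hφL : ∀ i, LinearMap.range (φ i) = (L i).1)
    (e : (∀ i, Fin (h i + 1)) ↪ Fin (n + 1)) :
    ProjectivelyEquivalent H (productVariety e φ hφ X) := by
  let A (i : Fin m) : Matrix (Fin (n + 1)) (Fin (h i + 1)) K := LinearMap.toMatrix' (φ i)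
  have hA : ∀ i, (A i).mulVecLin = φ i := fun i => Matrix.toLin'_toMatrix' (φ i)
  have hA' : ∀ i y, (A i).mulVec y = φ i y := fun i y => LinearMap.congr_fun (hA i) y
  have hinj : Function.Injective (productMatrix A).mulVecLin := by
    have hrank : Module.finrank K (LinearMap.range (productMatrix A).mulVecLin) =
        Fintype.card (∀ i, Fin (h i + 1)) := by
      rw [range_productMatrix, card_multiIndex]
      refine (mem_genericTuples_iff fun i => ?_).mp hL
      rw [hA, hφL]
    exact injective_of_finrank_range_eq (hrank.trans (Module.finrank_fintype_fun_eq_card K).symm)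
  -- Two injective linear maps out of the space of tensors differ by an automorphism of `K^(n+1)`;
  -- this is the required projective equivalence.
  obtain ⟨g, hg⟩ := exists_linearEquiv_comp_eq hinj (extendLinear_injective e)
  have hgφ : ∀ y : ∀ i, Fin (h i + 1) → K, g (∏ i, φ i (y i)) = segreVec e y := by
    intro y
    have := productMatrix_mulVec A y
    simp only [hA'] at this
    rw [← this]
    exact hg _
  refine ⟨g, Set.Subset.antisymm ?_ ?_⟩
  · rintro _ ⟨R, hR, rfl⟩
    rw [← R.mk_rep] at hR ⊢
    obtain ⟨p, hp, hr⟩ := (hH _ R.rep_nonzero).mp hR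
    choose hp0 hpX using hp
    have hrange : ∀ i, ∃ y, φ i y = p i := by
      intro i
      rw [← LinearMap.mem_range, hφL]
      exact (mk_mem_linearPoints (hp0 i)).mp (hXL i (hpX i))
    choose y hy using hrange
    have hy0 : ∀ i, y i ≠ 0 := by
      intro i hi
      exact hp0 i (by rw [← hy, hi, map_zero])
    refine ⟨fun i => Projectivization.mk K (y i) (hy0 i), fun i => ?_, ?_⟩
    · simpa [Projectivization.map_mk, hy] using hpX i
    · choose a ha using fun i => Projectivization.exists_smul_eq_mk_rep K (y i) (hy0 i)
      rw [Projectivization.map_mk, segre, Projectivization.mk_eq_mk_iff']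
      -- `segre` uses the chosen representatives, which differ from `y i` by the scalars `a i`; by
      -- multilinearity the Segre vector changes by their product.
      refine ⟨∏ i, (a i : K), ?_⟩
      simp only [← ha, Units.smul_def]
      rw [segreVec_smul, ← hgφ y, hr]
      simp [hy]
  · rintro _ ⟨P, hP, rfl⟩
    have hr : ∏ i, φ i (P i).rep ≠ 0 := by
      intro h0
      refine segreVec_ne_zero e (fun i => (P i).rep) (fun i => (P i).rep_nonzero) ?_
      rw [← hgφ, h0, map_zero]
    refine ⟨Projectivization.mk K _ hr, (hH _ hr).mpr ⟨_, fun i => ?_, rfl⟩, ?_⟩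
    · refine ⟨(map_ne_zero_iff _ (hφ i)).mpr (P i).rep_nonzero, ?_⟩
      have := hP i
      rw [← (P i).mk_rep, Projectivization.map_mk] at this
      exact this
    · rw [Projectivization.map_mk, segre]
      simp [hgφ]

end Generic

end HadamardVar

end

open HadamardVar in
theorem mainTheorem3 {K : Type*} [Field K] [IsAlgClosed K] [CharZero K]
    (n ℓ : ℕ) (h : Fin (ℓ + 1) → ℕ) (hn : (∏ i, (h i + 1)) - 1 ≤ n) :
    ∃ U : Set (∀ i, Grass K n (h i)), IsOpenGrass U ∧ U.Nonempty ∧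
      ∀ L ∈ U, ∀ X : Fin (ℓ + 1) → Set (ProjSpace K n),
        (∀ i, IsVariety (X i)) → (∀ i, X i ⊆ linearPoints (L i).1) →
          IsVariety (hadamardProd ℓ X) ∧
          (∀ (φ : ∀ i, (Fin (h i + 1) → K) →ₗ[K] (Fin (n + 1) → K))
            (hφ : ∀ i, Function.Injective (φ i)),
            (∀ i, LinearMap.range (φ i) = (L i).1) →
              ∀ e : (∀ i, Fin (h i + 1)) ↪ Fin (n + 1),
                ProjectivelyEquivalent (hadamardProd ℓ X) (productVariety e φ hφ X)) ∧
          ((∀ i, IsSmooth (X i)) → IsSmooth (hadamardProd ℓ X)) := by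
  refine ⟨genericTuples K n h, isOpenGrass_genericTuples, genericTuples_nonempty hn,
    fun L hL X hX hXL => ?_⟩
  obtain ⟨hvar, -, hmem, hsmooth⟩ := hadamardProd_properties ℓ (fun i => (L i).1)
    (fun i => by rw [(L i).2]; omega)
    (((mem_genericTuples_iff fun _ => rfl).mp hL).trans
      (Finset.prod_congr rfl fun i _ => (L i).2.symm)) X hX hXL
  exact ⟨hvar, fun φ hφ hφL e => projectivelyEquivalent_productVariety hL hXL hmem φ hφ hφL e,
    hsmooth⟩
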